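/- Let $M$ be a compact smooth manifold (without boundary) of dimension $n\ge 2$. Let $\mathrm{Met}(M)$ be the space of smooth Riemannian metrics on $M$, and let $\mathrm{Ini}(M)$ be the space of initial value pairs $(g,K)$, where $g\in\mathrm{Met}(M)$ and $K$ is a smooth symmetric $2$-tensor field on $M$; both carry the $C^\infty$-topology. Let $\mathrm{PSC}(M)\subset\mathrm{Met}(M)$ be the subspace of metrics whose scalar curvature $\mathrm{scal}^g$ is everywhere positive. Let $\mathrm{DEC}(M)\subset\mathrm{Ini}(M)$ be the subspace of pairs satisfying the dominant energy condition strictly, i.e. $\rho>\|j\|_g$ at every point of $M$, where $$2\rho=\mathrm{scal}^g+(\mathrm{tr}_g K)^2-\|K\|_g^2,\qquad j=\mathrm{div}_g K-\mathrm{d}\,\mathrm{tr}_g K .$$ Then the inclusion $\mathrm{PSC}(M)\to\mathrm{DEC}(M)$, $g\mapsto(g,0)$, is null-homotopic, i.e. homotopic to a constant map. In particular, for every $g_0\in\mathrm{PSC}(M)$ and every $k\ge 0$, the induced map $\pi_k(\mathrm{PSC}(M),g_0)\to\pi_k(\mathrm{DEC}(M),(g_0,0))$ is the zero map, i.e. it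 sends every element to the class of the constant map at $(g_0,0)$. -/

import Mathlib

open Bundle Manifold
open scoped Manifold ContDiff Topology Topology.Homotopy UniformConvergence

noncomputable section

namespace InitialData

/-! ### Tensor calculus in coordinates

Functions `G : ℝⁿ → Matrix (Fin n) (Fin n) ℝ` are the coefficients `g i j` of a metric in a chart,
and `K` those of a symmetric `2`-tensor. -/

section Coordinates

variable {n : ℕ}

/-- The partial derivative `∂ᵢ f` at `y`. -/
def partialDeriv (i : Fin n) (f : EuclideanSpace ℝ (Fin n) → ℝ) (y : EuclideanSpace ℝ (Fin n)) :
    ℝ :=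
  fderiv ℝ f y (EuclideanSpace.single i 1)

/-- The Christoffel symbol
`Γ^k_{ij} = 1/2 ∑ₗ g^{kl} (∂ᵢ g_{jl} + ∂ⱼ g_{il} - ∂ₗ g_{ij})`, where `g^{kl}` are the entries of
the inverse matrix. -/
def christoffel (G : EuclideanSpace ℝ (Fin n) → Matrix (Fin n) (Fin n) ℝ) (k i j : Fin n)
    (y : EuclideanSpace ℝ (Fin n)) : ℝ :=
  (1 / 2 : ℝ) * ∑ l, (G y)⁻¹ k l *
    (partialDeriv i (fun z => G z j l) y + partialDeriv j (fun z => G z i l) y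
      - partialDeriv l (fun z => G z i j) y)

/-- The Ricci curvature
`Ric_{ij} = ∑ₖ (∂ₖ Γ^k_{ij} - ∂ⱼ Γ^k_{ik}) + ∑ₖₗ (Γ^k_{kl} Γ^l_{ij} - Γ^k_{jl} Γ^l_{ik})`. -/
def ricci (G : EuclideanSpace ℝ (Fin n) → Matrix (Fin n) (Fin n) ℝ) (i j : Fin n)
    (y : EuclideanSpace ℝ (Fin n)) : ℝ :=
  ∑ k, (partialDeriv k (christoffel G k i j) y - partialDeriv j (christoffel G k i k) y)
    + ∑ k, ∑ l, (christoffel G k k l y * christoffel G l i j y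
      - christoffel G k j l y * christoffel G l i k y)

/-- The scalar curvature `∑ᵢⱼ g^{ij} Ric_{ij}`. -/
def scalarCurv (G : EuclideanSpace ℝ (Fin n) → Matrix (Fin n) (Fin n) ℝ)
    (y : EuclideanSpace ℝ (Fin n)) : ℝ :=
  ∑ i, ∑ j, (G y)⁻¹ i j * ricci G i j y

/-- The trace `tr K = ∑ᵢⱼ g^{ij} K_{ij}`. -/
def trace (G K : EuclideanSpace ℝ (Fin n) → Matrix (Fin n) (Fin n) ℝ)
    (y : EuclideanSpace ℝ (Fin n)) : ℝ :=
  ∑ i, ∑ j, (G y)⁻¹ i j * K y i j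

/-- The squared norm `‖K‖² = ∑ g^{ik} g^{jl} K_{ij} K_{kl}`. -/
def normSqTensor (G K : EuclideanSpace ℝ (Fin n) → Matrix (Fin n) (Fin n) ℝ)
    (y : EuclideanSpace ℝ (Fin n)) : ℝ :=
  ∑ i, ∑ j, ∑ k, ∑ l, (G y)⁻¹ i k * (G y)⁻¹ j l * K y i j * K y k l

/-- The Levi-Civita derivative
`(∇ᵢ K)_{jk} = ∂ᵢ K_{jk} - ∑ₗ (Γ^l_{ij} K_{lk} + Γ^l_{ik} K_{jl})`. -/
def nabla (G K : EuclideanSpace ℝ (Fin n) → Matrix (Fin n) (Fin n) ℝ) (i j k : Fin n)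
    (y : EuclideanSpace ℝ (Fin n)) : ℝ :=
  partialDeriv i (fun z => K z j k) y
    - ∑ l, (christoffel G l i j y * K y l k + christoffel G l i k y * K y j l)

/-- The divergence `(div K)ₖ = ∑ᵢⱼ g^{ij} (∇ᵢ K)_{jk}`. -/
def divergence (G K : EuclideanSpace ℝ (Fin n) → Matrix (Fin n) (Fin n) ℝ) (k : Fin n)
    (y : EuclideanSpace ℝ (Fin n)) : ℝ :=
  ∑ i, ∑ j, (G y)⁻¹ i j * nabla G K i j k y

/-- The momentum density `j = div K - d (tr K)` of the Einstein constraints. -/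
def momentum (G K : EuclideanSpace ℝ (Fin n) → Matrix (Fin n) (Fin n) ℝ) (k : Fin n)
    (y : EuclideanSpace ℝ (Fin n)) : ℝ :=
  divergence G K k y - partialDeriv k (trace G K) y

/-- The norm `‖j‖ = (∑ₖₗ g^{kl} jₖ jₗ)^{1/2}` of the momentum density. -/
def momentumNorm (G K : EuclideanSpace ℝ (Fin n) → Matrix (Fin n) (Fin n) ℝ)
    (y : EuclideanSpace ℝ (Fin n)) : ℝ :=
  Real.sqrt (∑ k, ∑ l, (G y)⁻¹ k l * momentum G K k y * momentum G K l y)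

/-- The energy density `ρ`, given by `2 ρ = scal + (tr K)² - ‖K‖²`. -/
def energy (G K : EuclideanSpace ℝ (Fin n) → Matrix (Fin n) (Fin n) ℝ)
    (y : EuclideanSpace ℝ (Fin n)) : ℝ :=
  (1 / 2 : ℝ) * (scalarCurv G y + trace G K y ^ 2 - normSqTensor G K y)

end Coordinates

/-! ### Fields of bilinear forms on a manifold -/

section Manifold

variable (n : ℕ) (M : Type*) [TopologicalSpace M] [ChartedSpace (EuclideanSpace ℝ (Fin n)) M]

/-- Fields of bilinear forms on the tangent spaces of `M`, with no regularity. -/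
abbrev BilinField : Type _ :=
  ∀ x : M, TangentSpace (𝓡 n) x →L[ℝ] TangentSpace (𝓡 n) x →L[ℝ] ℝ

variable {n M}

/-- The coefficients `T(∂ᵢ, ∂ⱼ)` of `T` in the chart `e`, where `∂ᵢ` is the image of the `i`-th
standard basis vector under the derivative of the inverse of the chart. They are meaningful on
`e.target`. -/
def coeff (e : OpenPartialHomeomorph M (EuclideanSpace ℝ (Fin n))) (T : BilinField n M)
    (y : EuclideanSpace ℝ (Fin n)) : Matrix (Fin n) (Fin n) ℝ :=
  Matrix.of fun i j =>
    T (e.symm y)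
      (mfderiv 𝓘(ℝ, EuclideanSpace ℝ (Fin n)) (𝓡 n) e.symm y (EuclideanSpace.single i 1))
      (mfderiv 𝓘(ℝ, EuclideanSpace ℝ (Fin n)) (𝓡 n) e.symm y (EuclideanSpace.single j 1))

variable (n M) in
/-- The `C^∞`-topology: the coarsest topology for which all derivatives of all coefficients in all
smooth charts depend continuously on the field, with respect to uniform convergence on compact
subsets of the (open) image of the chart. -/
@[reducible] def smoothTopology : TopologicalSpace (BilinField n M) :=
  ⨅ e ∈ IsManifold.maximalAtlas (𝓡 n) ∞ M, ⨅ i : Fin n, ⨅ j : Fin n, ⨅ k : ℕ,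
    TopologicalSpace.induced
      (fun T => UniformOnFun.ofFun
        {C : Set (EuclideanSpace ℝ (Fin n)) | IsCompact C ∧ C ⊆ e.target}
        (iteratedFDeriv ℝ k fun y => coeff e T y i j))
      inferInstance

variable (n M) [IsManifold (𝓡 n) ∞ M]

/-- The space of smooth Riemannian metrics on `M`. -/
def Met : Type _ :=
  ContMDiffRiemannianMetric (𝓡 n) ∞ (EuclideanSpace ℝ (Fin n))
    (fun x : M => TangentSpace (𝓡 n) x)

/-- Smooth sections of the bundle of symmetric bilinear forms on `TM`. -/
structure SymTensor where
  /-- The underlying field of bilinear forms. -/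
  field : BilinField n M
  symm (x : M) (v w : TangentSpace (𝓡 n) x) : field x v w = field x w v
  contMDiff : ContMDiff (𝓡 n)
    ((𝓡 n).prod 𝓘(ℝ, EuclideanSpace ℝ (Fin n) →L[ℝ] EuclideanSpace ℝ (Fin n) →L[ℝ] ℝ)) ∞
    (fun x => TotalSpace.mk' (EuclideanSpace ℝ (Fin n) →L[ℝ] EuclideanSpace ℝ (Fin n) →L[ℝ] ℝ)
      (E := fun x : M => TangentSpace (𝓡 n) x →L[ℝ] TangentSpace (𝓡 n) x →L[ℝ] ℝ) x (field x))

variable {n M}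

/-- The field of bilinear forms of a metric. -/
def Met.field (g : Met n M) : BilinField n M := ContMDiffRiemannianMetric.inner g

set_option synthInstance.maxHeartbeats 400000 in
set_option maxHeartbeats 1000000 in
instance : Zero (SymTensor n M) :=
  ⟨{field := fun _ => 0
    symm := fun _ _ _ => rfl
    contMDiff := contMDiff_zeroSection ℝ _ }⟩

/-- `Met(M)` carries the `C^∞`-topology. -/
instance : TopologicalSpace (Met n M) :=
  TopologicalSpace.induced Met.field (smoothTopology n M)

instance : TopologicalSpace (SymTensor n M) :=
  TopologicalSpace.induced SymTensor.field (smoothTopology n M)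

/-- The scalar curvature of `g` at `x`. -/
def Met.scal (g : Met n M) (x : M) : ℝ :=
  let e := chartAt (EuclideanSpace ℝ (Fin n)) x
  scalarCurv (coeff e g.field) (e x)

variable (n M) in
/-- The space of initial value pairs `(g, K)`, with the `C^∞`-topology. -/
abbrev Ini : Type _ := Met n M × SymTensor n M

/-- The energy density `ρ` of `(g, K)` at `x`. -/
def Ini.rho (p : Ini n M) (x : M) : ℝ :=
  let e := chartAt (EuclideanSpace ℝ (Fin n)) x
  energy (coeff e p.1.field) (coeff e p.2.field) (e x)

/-- The norm `‖j‖` of the momentum density of `(g, K)` at `x`. -/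
def Ini.normJ (p : Ini n M) (x : M) : ℝ :=
  let e := chartAt (EuclideanSpace ℝ (Fin n)) x
  momentumNorm (coeff e p.1.field) (coeff e p.2.field) (e x)

variable (n M) in
/-- The space of metrics of positive scalar curvature, a subspace of `Met(M)`. -/
abbrev PSC : Type _ := {g : Met n M // ∀ x, 0 < g.scal x}

variable (n M) in
/-- The space of initial value pairs satisfying the dominant energy condition strictly, a
subspace of `Ini(M)`. -/
abbrev DEC : Type _ := {p : Ini n M // ∀ x, p.normJ x < p.rho x}

theorem coeff_zero (e : OpenPartialHomeomorph M (EuclideanSpace ℝ (Fin n)))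
    (y : EuclideanSpace ℝ (Fin n)) : coeff e (0 : SymTensor n M).field y = 0 := by
  ext i j
  rfl

theorem strict_of_scal_pos (g : Met n M) (hg : ∀ x, 0 < g.scal x) (x : M) :
    Ini.normJ (g, (0 : SymTensor n M)) x < Ini.rho (g, (0 : SymTensor n M)) x := by
  have h := hg x
  have hz : ∀ e : OpenPartialHomeomorph M (EuclideanSpace ℝ (Fin n)),
      coeff e (0 : SymTensor n M).field = fun _ => 0 := fun e => funext (coeff_zero e)
  have ht : ∀ G : EuclideanSpace ℝ (Fin n) → Matrix (Fin n) (Fin n) ℝ,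
      trace G (fun _ => 0) = fun _ => 0 := fun G => by
    funext y
    simp [trace]
  simp only [Met.scal] at h
  simp [Ini.normJ, Ini.rho, hz, momentumNorm, momentum, divergence, nabla, energy, ht,
    normSqTensor, partialDeriv, h]

variable (n M) in
/-- The inclusion `g ↦ (g, 0)` of `PSC(M)` into `DEC(M)`. -/
def incl : C(PSC n M, DEC n M) where
  toFun g := ⟨(g.1, 0), strict_of_scal_pos g.1 g.2⟩
  continuous_toFun := by fun_prop

end Manifold

/-! ### Induced maps on homotopy groups -/

section Homotopy

variable {X Y : Type*} [TopologicalSpace X] [TopologicalSpace Y]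

/-- The composition of a map `(I^k, ∂I^k) → (X, x)` with `f : X → Y`. -/
def mapGenLoop (f : C(X, Y)) (k : ℕ) (x : X) (γ : Ω^ (Fin k) X x) : Ω^ (Fin k) Y (f x) :=
  ⟨f.comp γ.1, fun y hy => congrArg f (γ.2 y hy)⟩

/-- The map `π_k(X, x) → π_k(Y, f(x))` induced by `f`. -/
def mapPi (f : C(X, Y)) (k : ℕ) (x : X) : π_ k X x → π_ k Y (f x) :=
  Quotient.map (mapGenLoop f k x) fun _ _ h => h.comp_continuousMap f

/-- The base point of `π_k(X, x)`, the class of the constant map (the neutral element if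
`k ≥ 1`). -/
def zeroPi (k : ℕ) (x : X) : π_ k X x :=
  Quotient.mk _ (GenLoop.const : Ω^ (Fin k) X x)

end Homotopy

end InitialData

end

noncomputable section

set_option maxSynthPendingDepth 3

namespace InitialData

/-! A pure-trace tensor `K = c g` with `c` constant has `∇K = 0` and constant trace, so its momentum
density vanishes, and `2ρ = scal + n(n-1)c²`. Since `n(n-1) ≥ 1` for `n ≥ 2`, the pair `(g, c g)`
satisfies the strict dominant energy condition as soon as `scal + c² > 0`. Any path of metrics can
thus be lifted into `DEC(M)` by taking `c` large while the scalar curvature is negative somewhere.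

Fix `g₀` of positive scalar curvature and let `m(g) = max (-scal g)`, which is negative on `PSC(M)`.
Along the segment `g_s = (1-s)g + s g₀` take `c = √(m(g_s) + min(-m(g), -m(g₀)))`, the root being
`0` for a negative radicand. Then `scal + c² > 0` throughout, and `c = 0` at `s = 0`, at `s = 1`,
and for all `s` when `g = g₀`. This contracts the inclusion onto `(g₀, 0)` relative to `g₀`, hence
also kills the maps on homotopy groups (`incl_homotopicRel_const`, `mapPi_eq_zeroPi`).

The analytic burden is the continuity of `m`. By compactness of `M` it follows from joint continuity
of `scal` in the metric and the point (`Met.continuous_scal`). As `scal` at `x` is computed in the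
preferred chart at `x`, which may jump with `x`, this needs the chart independence of scalar
curvature (`scalarCurvIn_pullback`, `Met.scal_eq`). It is proved by transforming the Christoffel
symbols, the curvature tensor and its traces in turn. -/

theorem two_le_infty : minSmoothness ℝ 2 ≤ ∞ := by
  rw [minSmoothness_of_isRCLikeNormedField]
  exact ENat.LEInfty.out

/-! ### Transformation of connection and curvature under a change of coordinates. -/

section Curvature

variable {E : Type*} [NormedAddCommGroup E] [NormedSpace ℝ E]

/-- The curvature tensor `R(u, v)w` of the connection with Christoffel symbols `Γ`. -/
def curvature (Γ : E → E →L[ℝ] E →L[ℝ] E) (y u v w : E) : E :=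
  fderiv ℝ Γ y u v w - fderiv ℝ Γ y v u w + Γ y u (Γ y v w) - Γ y v (Γ y u w)

/-- The Koszul formula for the Christoffel symbols `Γ` of `g` at `y`. -/
def IsKoszulAt (g : E → E →L[ℝ] E →L[ℝ] ℝ) (Γ : E → E →L[ℝ] E →L[ℝ] E) (y : E) : Prop :=
  ∀ u v w, g y (Γ y u v) w =
    (1 / 2 : ℝ) * (fderiv ℝ g y u v w + fderiv ℝ g y v u w - fderiv ℝ g y w u v)

theorem fderiv_pullback {g h : E → E →L[ℝ] E →L[ℝ] ℝ} {φ : E → E} {y : E}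
    (hφ : ContDiffAt ℝ ∞ φ y) (hg : DifferentiableAt ℝ g (φ y)) (hh : DifferentiableAt ℝ h y)
    (hgh : ∀ᶠ z in 𝓝 y, ∀ u v, h z u v = g (φ z) (fderiv ℝ φ z u) (fderiv ℝ φ z v)) (u v w : E) :
    fderiv ℝ h y u v w = fderiv ℝ g (φ y) (fderiv ℝ φ y u) (fderiv ℝ φ y v) (fderiv ℝ φ y w)
      + g (φ y) (fderiv ℝ (fderiv ℝ φ) y u v) (fderiv ℝ φ y w)
      + g (φ y) (fderiv ℝ φ y v) (fderiv ℝ (fderiv ℝ φ) y u w) := by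
  have hd : DifferentiableAt ℝ φ y := hφ.differentiableAt (by simp)
  have hA : DifferentiableAt ℝ (fderiv ℝ φ) y :=
    (hφ.fderiv_right (m := 1) (by norm_cast)).differentiableAt (by simp)
  have h1 : HasFDerivAt (fun z => h z v w) _ y :=
    (hh.hasFDerivAt.clm_apply (hasFDerivAt_const v y)).clm_apply (hasFDerivAt_const w y)
  have h2 : HasFDerivAt (fun z => g (φ z) (fderiv ℝ φ z v) (fderiv ℝ φ z w)) _ y :=
    ((hg.hasFDerivAt.comp y hd.hasFDerivAt).clm_apply
      (hA.hasFDerivAt.clm_apply (hasFDerivAt_const v y))).clm_apply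
      (hA.hasFDerivAt.clm_apply (hasFDerivAt_const w y))
  have h3 := (h2.congr_of_eventuallyEq (hgh.mono fun z hz => hz v w)).unique h1
  have h4 := congrArg (fun L => L u) h3
  simp at h4
  rw [← h4]
  ring

/-- In the Koszul formula for the pulled-back metric, six terms contain second derivatives of `φ`.
By symmetry of `g` and of `D²φ` four of them cancel and the other two agree, leaving `g(D²φ(u, v),
Dφ w)`. Surjectivity of `Dφ` and nondegeneracy of `g` then allow `w` to be removed. -/
theorem christoffel_pullback {g h : E → E →L[ℝ] E →L[ℝ] ℝ} {Γ Δ : E → E →L[ℝ] E →L[ℝ] E}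
    {φ : E → E} {y : E}
    (hφ : ContDiffAt ℝ ∞ φ y) (hg : DifferentiableAt ℝ g (φ y)) (hh : DifferentiableAt ℝ h y)
    (hgh : ∀ᶠ z in 𝓝 y, ∀ u v, h z u v = g (φ z) (fderiv ℝ φ z u) (fderiv ℝ φ z v))
    (hsymm : ∀ u v, g (φ y) u v = g (φ y) v u)
    (hnd : ∀ u, (∀ v, g (φ y) u v = 0) → u = 0)
    (hsurj : Function.Surjective (fderiv ℝ φ y))
    (hΓ : IsKoszulAt g Γ (φ y)) (hΔ : IsKoszulAt h Δ y) (u v : E) :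
    fderiv ℝ φ y (Δ y u v) =
      fderiv ℝ (fderiv ℝ φ) y u v + Γ (φ y) (fderiv ℝ φ y u) (fderiv ℝ φ y v) := by
  rw [← sub_eq_zero]
  refine hnd _ fun w' => ?_
  obtain ⟨w, rfl⟩ := hsurj w'
  have hs : ∀ a b, fderiv ℝ (fderiv ℝ φ) y a b = fderiv ℝ (fderiv ℝ φ) y b a :=
    fun a b => (hφ.isSymmSndFDerivAt two_le_infty).eq a b
  have k1 := hΔ u v w
  rw [hgh.self_of_nhds] at k1
  have k2 := hΓ (fderiv ℝ φ y u) (fderiv ℝ φ y v) (fderiv ℝ φ y w)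
  have p := fderiv_pullback hφ hg hh hgh
  rw [p, p, p] at k1
  simp only [map_sub, map_add, sub_apply, add_apply]
  rw [k1, k2, hs v u, hs w u, hs w v, hsymm (fderiv ℝ φ y v) (fderiv ℝ (fderiv ℝ φ) y u w),
    hsymm (fderiv ℝ φ y u) (fderiv ℝ (fderiv ℝ φ) y v w)]
  ring

/-- Differentiate the transformation law of the Christoffel symbols and antisymmetrize in `u, v`.
The third derivatives of `φ` drop out by symmetry, and the terms with second derivatives cancel
against those from the quadratic part of the curvature. -/
theorem curvature_pullback {Γ Δ : E → E →L[ℝ] E →L[ℝ] E} {φ : E → E} {y : E}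
    (hφ : ContDiffAt ℝ ∞ φ y) (hΓ : DifferentiableAt ℝ Γ (φ y)) (hΔ : DifferentiableAt ℝ Δ y)
    (hsymm : ∀ u v, Γ (φ y) u v = Γ (φ y) v u)
    (h : ∀ᶠ z in 𝓝 y, ∀ u v, fderiv ℝ φ z (Δ z u v) =
      fderiv ℝ (fderiv ℝ φ) z u v + Γ (φ z) (fderiv ℝ φ z u) (fderiv ℝ φ z v)) (u v w : E) :
    fderiv ℝ φ y (curvature Δ y u v w) =
      curvature Γ (φ y) (fderiv ℝ φ y u) (fderiv ℝ φ y v) (fderiv ℝ φ y w) := by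
  have hd : DifferentiableAt ℝ φ y := hφ.differentiableAt (by simp)
  have hA1 : ContDiffAt ℝ ∞ (fderiv ℝ φ) y := hφ.fderiv_right (by simp)
  have hA : DifferentiableAt ℝ (fderiv ℝ φ) y := hA1.differentiableAt (by simp)
  have hA2 : DifferentiableAt ℝ (fderiv ℝ (fderiv ℝ φ)) y :=
    (hA1.fderiv_right (m := 1) (by norm_cast)).differentiableAt (by simp)
  have hs : ∀ a b, fderiv ℝ (fderiv ℝ φ) y a b = fderiv ℝ (fderiv ℝ φ) y b a :=
    fun a b => (hφ.isSymmSndFDerivAt two_le_infty).eq a b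
  have hs3 : ∀ a b c, fderiv ℝ (fderiv ℝ (fderiv ℝ φ)) y a b c =
      fderiv ℝ (fderiv ℝ (fderiv ℝ φ)) y b a c :=
    fun a b c => congrArg (fun L => L c) ((hA1.isSymmSndFDerivAt two_le_infty).eq a b)
  have key : ∀ u v w, fderiv ℝ φ y (fderiv ℝ Δ y u v w) =
      fderiv ℝ (fderiv ℝ (fderiv ℝ φ)) y u v w
      + fderiv ℝ Γ (φ y) (fderiv ℝ φ y u) (fderiv ℝ φ y v) (fderiv ℝ φ y w)
      + Γ (φ y) (fderiv ℝ (fderiv ℝ φ) y u v) (fderiv ℝ φ y w)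
      + Γ (φ y) (fderiv ℝ φ y v) (fderiv ℝ (fderiv ℝ φ) y u w)
      - fderiv ℝ (fderiv ℝ φ) y u (Δ y v w) := by
    intro u v w
    have h1 : HasFDerivAt (fun z => fderiv ℝ φ z (Δ z v w)) _ y :=
      hA.hasFDerivAt.clm_apply
        ((hΔ.hasFDerivAt.clm_apply (hasFDerivAt_const v y)).clm_apply (hasFDerivAt_const w y))
    have h2 : HasFDerivAt (fun z => fderiv ℝ (fderiv ℝ φ) z v w +
        Γ (φ z) (fderiv ℝ φ z v) (fderiv ℝ φ z w)) _ y :=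
      ((hA2.hasFDerivAt.clm_apply (hasFDerivAt_const v y)).clm_apply
        (hasFDerivAt_const w y)).add
      (((hΓ.hasFDerivAt.comp y hd.hasFDerivAt).clm_apply
      (hA.hasFDerivAt.clm_apply (hasFDerivAt_const v y))).clm_apply
      (hA.hasFDerivAt.clm_apply (hasFDerivAt_const w y)))
    have h3 := (h2.congr_of_eventuallyEq (h.mono fun z hz => hz v w)).unique h1
    have h4 := congrArg (fun L => L u) h3
    simp at h4
    rw [eq_sub_iff_add_eq, ← h4]
    abel
  have h0 := h.self_of_nhds
  simp only [curvature, map_sub, map_add, key, h0]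
  rw [hs3 v u w, hs v u, hsymm (fderiv ℝ φ y v) (fderiv ℝ (fderiv ℝ φ) y u w),
    hsymm (fderiv ℝ φ y u) (fderiv ℝ (fderiv ℝ φ) y v w)]
  abel

end Curvature

/-! ### Tensor calculus with respect to a basis of a normed space -/

section Basis

variable {n : ℕ} {E : Type*} [NormedAddCommGroup E] [NormedSpace ℝ E]

theorem clm_ext_basis (b : Module.Basis (Fin n) ℝ E) {F : Type*} [NormedAddCommGroup F]
    [NormedSpace ℝ F] {L L' : E →L[ℝ] F} (h : ∀ i, L (b i) = L' (b i)) : L = L' :=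
  ContinuousLinearMap.coe_injective (b.ext (f₁ := L.toLinearMap) (f₂ := L'.toLinearMap) h)

theorem contDiffAt_fderiv_apply {f : E → ℝ} {y : E} (hf : ContDiffAt ℝ ∞ f y) (v : E) :
    ContDiffAt ℝ ∞ (fun z => fderiv ℝ f z v) y :=
  (hf.fderiv_right (m := ∞) (by simp)).clm_apply contDiffAt_const

theorem contDiffAt_det {A : E → Matrix (Fin n) (Fin n) ℝ}
    {y : E} (hA : ∀ i j, ContDiffAt ℝ ∞ (fun z => A z i j) y) :
    ContDiffAt ℝ ∞ (fun z => (A z).det) y := by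
  simp only [Matrix.det_apply']
  exact ContDiffAt.sum fun σ _ => contDiffAt_const.mul (contDiffAt_prod fun i _ => hA _ _)

theorem contDiffAt_inv {A : E → Matrix (Fin n) (Fin n) ℝ}
    {y : E} (hA : ∀ i j, ContDiffAt ℝ ∞ (fun z => A z i j) y)
    (hd : (A y).det ≠ 0) (i j : Fin n) : ContDiffAt ℝ ∞ (fun z => (A z)⁻¹ i j) y := by
  simp only [Matrix.inv_def, Matrix.smul_apply, Matrix.adjugate_apply, Ring.inverse_eq_inv',
    smul_eq_mul]
  refine ((contDiffAt_det hA).inv hd).mul (contDiffAt_det fun a b => ?_)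
  simp only [Matrix.updateRow_apply]
  split_ifs
  · exact contDiffAt_const
  · exact hA _ _

variable (b : Module.Basis (Fin n) ℝ E)

/-- The Christoffel symbols with respect to the basis `b`. -/
def christoffelIn (G : E → Matrix (Fin n) (Fin n) ℝ) (k i j : Fin n) (y : E) : ℝ :=
  (1 / 2 : ℝ) * ∑ l, (G y)⁻¹ k l *
    (fderiv ℝ (fun z => G z j l) y (b i) + fderiv ℝ (fun z => G z i l) y (b j)
      - fderiv ℝ (fun z => G z i j) y (b l))

/-- The Ricci curvature with respect to the basis `b`. -/
def ricciIn (G : E → Matrix (Fin n) (Fin n) ℝ) (i j : Fin n) (y : E) : ℝ :=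
  ∑ k, (fderiv ℝ (christoffelIn b G k i j) y (b k) - fderiv ℝ (christoffelIn b G k i k) y (b j))
    + ∑ k, ∑ l, (christoffelIn b G k k l y * christoffelIn b G l i j y
      - christoffelIn b G k j l y * christoffelIn b G l i k y)

/-- The scalar curvature with respect to the basis `b`. -/
def scalarCurvIn (G : E → Matrix (Fin n) (Fin n) ℝ) (y : E) : ℝ :=
  ∑ i, ∑ j, (G y)⁻¹ i j * ricciIn b G i j y

variable [FiniteDimensional ℝ E]

/-- The `i`-th coordinate, as a continuous linear form. -/
def coordCLM (i : Fin n) : E →L[ℝ] ℝ := (b.coord i).toContinuousLinearMap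

theorem coordCLM_apply (i : Fin n) (u : E) : coordCLM b i u = b.repr u i := rfl

/-- The bilinear form with matrix `A`. -/
def bilinOfMatrix (A : Matrix (Fin n) (Fin n) ℝ) : E →L[ℝ] E →L[ℝ] ℝ :=
  ∑ i, ∑ j, A i j • (coordCLM b i).smulRight (coordCLM b j)

/-- The bilinear map whose components are the Christoffel symbols. -/
def christoffelMap (G : E → Matrix (Fin n) (Fin n) ℝ) (y : E) : E →L[ℝ] E →L[ℝ] E :=
  ∑ k, ∑ i, ∑ j, christoffelIn b G k i j y •
    (coordCLM b i).smulRight ((coordCLM b j).smulRight (b k))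

theorem bilinOfMatrix_apply (A : Matrix (Fin n) (Fin n) ℝ) (u v : E) :
    bilinOfMatrix b A u v = ∑ i, ∑ j, A i j * (b.repr u i * b.repr v j) := by
  simp [bilinOfMatrix, sum_apply, coordCLM_apply]

theorem bilinOfMatrix_basis (A : Matrix (Fin n) (Fin n) ℝ) (i j : Fin n) :
    bilinOfMatrix b A (b i) (b j) = A i j := by
  simp [bilinOfMatrix_apply, Finsupp.single_apply]

theorem christoffelMap_apply (G : E → Matrix (Fin n) (Fin n) ℝ) (y u v : E) (k : Fin n) :
    b.repr (christoffelMap b G y u v) k =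
      ∑ i, ∑ j, christoffelIn b G k i j y * (b.repr u i * b.repr v j) := by
  simp [christoffelMap, sum_apply, Finsupp.single_apply, coordCLM_apply]

theorem christoffelMap_basis_left (G : E → Matrix (Fin n) (Fin n) ℝ) (y v : E) (i k : Fin n) :
    b.repr (christoffelMap b G y (b i) v) k = ∑ j, christoffelIn b G k i j y * b.repr v j := by
  rw [christoffelMap_apply, Finset.sum_eq_single i]
  · simp
  · intro a _ ha
    simp [ha.symm]
  · simp

theorem christoffelMap_basis (G : E → Matrix (Fin n) (Fin n) ℝ) (y : E) (i j k : Fin n) :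
    b.repr (christoffelMap b G y (b i) (b j)) k = christoffelIn b G k i j y := by
  simp [christoffelMap_basis_left, Finsupp.single_apply]

variable {G : E → Matrix (Fin n) (Fin n) ℝ} {y : E}

theorem contDiffAt_bilinOfMatrix (hG : ∀ i j, ContDiffAt ℝ ∞ (fun z => G z i j) y) :
    ContDiffAt ℝ ∞ (fun z => bilinOfMatrix b (G z)) y :=
  ContDiffAt.sum fun i _ => ContDiffAt.sum fun j _ => (hG i j).smul contDiffAt_const

omit [FiniteDimensional ℝ E] in
theorem contDiffAt_christoffelIn (hG : ∀ i j, ContDiffAt ℝ ∞ (fun z => G z i j) y)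
    (hd : (G y).det ≠ 0) (k i j : Fin n) : ContDiffAt ℝ ∞ (christoffelIn b G k i j) y :=
  contDiffAt_const.mul <| ContDiffAt.sum fun _ _ => (contDiffAt_inv hG hd _ _).mul <|
    ((contDiffAt_fderiv_apply (hG _ _) _).add (contDiffAt_fderiv_apply (hG _ _) _)).sub
      (contDiffAt_fderiv_apply (hG _ _) _)

theorem contDiffAt_christoffelMap (hG : ∀ i j, ContDiffAt ℝ ∞ (fun z => G z i j) y)
    (hd : (G y).det ≠ 0) : ContDiffAt ℝ ∞ (christoffelMap b G) y :=
  ContDiffAt.sum fun _ _ => ContDiffAt.sum fun _ _ => ContDiffAt.sum fun _ _ =>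
    (contDiffAt_christoffelIn b hG hd _ _ _).smul contDiffAt_const

theorem fderiv_bilinOfMatrix (hG : ∀ i j, ContDiffAt ℝ ∞ (fun z => G z i j) y) (k i j : Fin n) :
    fderiv ℝ (fun z => bilinOfMatrix b (G z)) y (b k) (b i) (b j) =
      fderiv ℝ (fun z => G z i j) y (b k) := by
  have hd : DifferentiableAt ℝ (fun z => bilinOfMatrix b (G z)) y :=
    (contDiffAt_bilinOfMatrix b hG).differentiableAt (by simp)
  have h1 := (hd.hasFDerivAt.clm_apply (hasFDerivAt_const (b i) y)).clm_apply
    (hasFDerivAt_const (b j) y)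
  simp only [bilinOfMatrix_basis] at h1
  rw [h1.fderiv]
  simp

omit [FiniteDimensional ℝ E] in
theorem fderiv_symm (hs : ∀ᶠ z in 𝓝 y, (G z).IsSymm) (i j : Fin n) :
    fderiv ℝ (fun z => G z i j) y = fderiv ℝ (fun z => G z j i) y :=
  Filter.EventuallyEq.fderiv_eq (hs.mono fun _ hx => hx.apply j i)

omit [FiniteDimensional ℝ E] in
theorem christoffelIn_symm (hs : ∀ᶠ z in 𝓝 y, (G z).IsSymm) (k i j : Fin n) :
    christoffelIn b G k i j =ᶠ[𝓝 y] christoffelIn b G k j i := by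
  filter_upwards [eventually_eventually_nhds.2 hs] with z hz
  simp only [christoffelIn, fderiv_symm hz i j]
  congr 1
  exact Finset.sum_congr rfl fun l _ => by ring

omit [FiniteDimensional ℝ E] in
-- Lowering the upper index cancels the inverse matrix in the Christoffel symbols. This form serves
-- both the Koszul formula and `∇g = 0`.
theorem sum_mul_christoffelIn (hs : (G y).IsSymm) (hd : (G y).det ≠ 0) (m i j : Fin n) :
    ∑ k, G y k m * christoffelIn b G k i j y = (1 / 2 : ℝ) *
      (fderiv ℝ (fun z => G z j m) y (b i) + fderiv ℝ (fun z => G z i m) y (b j)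
        - fderiv ℝ (fun z => G z i j) y (b m)) := by
  have h : ∀ k, G y k m * christoffelIn b G k i j y = (1 / 2 : ℝ) *
      ∑ l, (G y m k * (G y)⁻¹ k l) *
        (fderiv ℝ (fun z => G z j l) y (b i) + fderiv ℝ (fun z => G z i l) y (b j)
          - fderiv ℝ (fun z => G z i j) y (b l)) := by
    intro k
    rw [christoffelIn, ← hs.apply m k, mul_left_comm, Finset.mul_sum]
    simp only [mul_assoc]
  simp only [h]
  rw [← Finset.mul_sum, Finset.sum_comm]
  simp only [← Finset.sum_mul]
  have hinv : ∀ l, ∑ k, G y m k * (G y)⁻¹ k l = (1 : Matrix (Fin n) (Fin n) ℝ) m l := by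
    intro l
    rw [← Matrix.mul_apply, Matrix.mul_nonsing_inv _ (isUnit_iff_ne_zero.2 hd)]
  simp [hinv, Matrix.one_apply]

theorem isKoszulAt_christoffelMap (hG : ∀ i j, ContDiffAt ℝ ∞ (fun z => G z i j) y)
    (hs : ∀ᶠ z in 𝓝 y, (G z).IsSymm) (hd : (G y).det ≠ 0) :
    IsKoszulAt (fun z => bilinOfMatrix b (G z)) (christoffelMap b G) y := by
  set D := fderiv ℝ (fun z => bilinOfMatrix b (G z)) y with hD
  -- Both sides are trilinear in `u, v, w`. Written as equal linear maps, they need only be compared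
  -- on basis vectors.
  have key : (ContinuousLinearMap.compL ℝ E E (E →L[ℝ] ℝ) (bilinOfMatrix b (G y))).comp
      (christoffelMap b G y) = (1 / 2 : ℝ) • (D + D.flip -
        (ContinuousLinearMap.flipₗᵢ ℝ E E ℝ).toContinuousLinearEquiv.toContinuousLinearMap.comp
          D.flip) := by
    refine clm_ext_basis b fun i => clm_ext_basis b fun j => clm_ext_basis b fun m => ?_
    have e1 : bilinOfMatrix b (G y) (christoffelMap b G y (b i) (b j)) (b m) =
        (1 / 2 : ℝ) * (D (b i) (b j) (b m) + D (b j) (b i) (b m) - D (b m) (b i) (b j)) := by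
      simp only [hD, fderiv_bilinOfMatrix b hG]
      rw [← sum_mul_christoffelIn b hs.self_of_nhds hd, bilinOfMatrix_apply]
      simp [christoffelMap_basis, Finsupp.single_apply]
    exact e1
  intro u v w
  exact congrArg (fun L : E →L[ℝ] E →L[ℝ] E →L[ℝ] ℝ => L u v w) key

/-- The coordinate formula for `Ric_{ij}` is the trace of `u ↦ R(u, ∂ⱼ)∂ᵢ`, up to symmetry of the
Christoffel symbols in their lower indices. A trace is what can be compared in different
coordinates. -/
theorem ricciIn_eq_sum_curvature (hG : ∀ i j, ContDiffAt ℝ ∞ (fun z => G z i j) y)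
    (hs : ∀ᶠ z in 𝓝 y, (G z).IsSymm) (hd : (G y).det ≠ 0) (i j : Fin n) :
    ricciIn b G i j y =
      ∑ k, b.repr (curvature (christoffelMap b G) y (b k) (b j) (b i)) k := by
  have hder : ∀ l p q k, b.repr (fderiv ℝ (christoffelMap b G) y (b l) (b p) (b q)) k =
      fderiv ℝ (christoffelIn b G k p q) y (b l) := by
    intro l p q k
    have h1 := (coordCLM b k).hasFDerivAt.comp y
      ((((contDiffAt_christoffelMap b hG hd).differentiableAt (by simp)).hasFDerivAt.clm_apply
      (hasFDerivAt_const (b p) y)).clm_apply (hasFDerivAt_const (b q) y))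
    simp only [Function.comp_def, coordCLM_apply, christoffelMap_basis] at h1
    rw [h1.fderiv]
    simp [coordCLM_apply]
  have hps : ∀ k p q, fderiv ℝ (christoffelIn b G k p q) y =
      fderiv ℝ (christoffelIn b G k q p) y :=
    fun k p q => (christoffelIn_symm b hs k p q).fderiv_eq
  have hsy : ∀ k p q, christoffelIn b G k p q y = christoffelIn b G k q p y :=
    fun k p q => (christoffelIn_symm b hs k p q).self_of_nhds
  simp only [curvature, map_add, map_sub, Finsupp.add_apply, Finsupp.sub_apply, hder,
    christoffelMap_basis_left _ _ _ (christoffelMap b G y _ _), christoffelMap_basis]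
  rw [ricciIn, ← Finset.sum_add_distrib]
  refine Finset.sum_congr rfl fun k _ => ?_
  rw [Finset.sum_sub_distrib, hps k j i, hps k k i, add_sub_assoc]
  congr 2
  · exact Finset.sum_congr rfl fun l _ => by rw [hsy l i j]
  · exact Finset.sum_congr rfl fun l _ => by rw [hsy l i k]

end Basis

/-! ### Coordinate invariance of Ricci and scalar curvature. -/

section Invariance

variable {n : ℕ} {E : Type*} [NormedAddCommGroup E] [NormedSpace ℝ E] [FiniteDimensional ℝ E]
  (b : Module.Basis (Fin n) ℝ E)

/-- The trace of `u ↦ R(u, v)w`. -/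
def ricciForm (Γ : E → E →L[ℝ] E →L[ℝ] E) (y v w : E) : ℝ :=
  ∑ k, b.repr (curvature Γ y (b k) v w) k

omit [FiniteDimensional ℝ E] in
theorem ricciForm_eq_trace (Γ : E → E →L[ℝ] E →L[ℝ] E) (y v w : E) (L : E →ₗ[ℝ] E)
    (hL : ∀ u, L u = curvature Γ y u v w) : ricciForm b Γ y v w = LinearMap.trace ℝ E L := by
  rw [LinearMap.trace_eq_matrix_trace ℝ b, Matrix.trace]
  simp [ricciForm, LinearMap.toMatrix_apply, hL]

/-- `u ↦ R(u, v)w` as a linear map. -/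
def curvatureLinear (Γ : E → E →L[ℝ] E →L[ℝ] E) (y v w : E) : E →ₗ[ℝ] E where
  toFun u := curvature Γ y u v w
  map_add' u u' := by simp [curvature]; abel
  map_smul' c u := by simp [curvature, smul_sub]

omit [FiniteDimensional ℝ E] in
-- The endomorphisms `u ↦ R(u, v)w` on the two sides are conjugate by `A`, so they have the same
-- trace.
theorem ricciForm_pullback {Γ Δ : E → E →L[ℝ] E →L[ℝ] E} {y y' : E} (A : E ≃L[ℝ] E)
    (h : ∀ u v w, A (curvature Δ y u v w) = curvature Γ y' (A u) (A v) (A w)) (v w : E) :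
    ricciForm b Δ y v w = ricciForm b Γ y' (A v) (A w) := by
  rw [ricciForm_eq_trace b Γ y' (A v) (A w) (curvatureLinear Γ y' (A v) (A w)) fun _ => rfl,
    ← LinearMap.trace_conj' _ A.symm.toLinearEquiv]
  refine ricciForm_eq_trace b Δ y v w _ fun u => ?_
  rw [LinearEquiv.conj_apply]
  apply A.injective
  rw [h]
  simp [curvatureLinear]

theorem bilinOfMatrix_eq_dotProduct (A : Matrix (Fin n) (Fin n) ℝ) (u v : E) :
    bilinOfMatrix b A u v = (b.repr u ⬝ᵥ A.mulVec (b.repr v) : ℝ) := by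
  simp only [bilinOfMatrix_apply, dotProduct, Matrix.mulVec, Finset.mul_sum]
  exact Finset.sum_congr rfl fun i _ => Finset.sum_congr rfl fun j _ => by ring

theorem bilinOfMatrix_symm {A : Matrix (Fin n) (Fin n) ℝ} (hA : A.IsSymm) (u v : E) :
    bilinOfMatrix b A u v = bilinOfMatrix b A v u := by
  rw [bilinOfMatrix_apply, bilinOfMatrix_apply, Finset.sum_comm]
  exact Finset.sum_congr rfl fun i _ => Finset.sum_congr rfl fun j _ => by
    rw [hA.apply i j, mul_comm (b.repr u j)]

theorem bilinOfMatrix_nondegenerate {A : Matrix (Fin n) (Fin n) ℝ} (hA : A.det ≠ 0) {u : E}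
    (h : ∀ v, bilinOfMatrix b A u v = 0) : u = 0 := by
  have h1 : Matrix.vecMul (b.repr u) A = 0 := by
    ext j
    have := h (b j)
    simp only [bilinOfMatrix_eq_dotProduct, Matrix.dotProduct_mulVec] at this
    simpa [Finsupp.single_eq_pi_single] using this
  have h2 := Matrix.eq_zero_of_vecMul_eq_zero hA h1
  exact b.repr.map_eq_zero_iff.1 (DFunLike.coe_injective h2)

theorem christoffelMap_symm {G : E → Matrix (Fin n) (Fin n) ℝ} {y : E}
    (hs : ∀ᶠ z in 𝓝 y, (G z).IsSymm) (u v : E) :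
    christoffelMap b G y u v = christoffelMap b G y v u := by
  refine b.repr.injective (Finsupp.ext fun k => ?_)
  rw [christoffelMap_apply, christoffelMap_apply, Finset.sum_comm]
  exact Finset.sum_congr rfl fun i _ => Finset.sum_congr rfl fun j _ => by
    rw [(christoffelIn_symm b hs k i j).self_of_nhds, mul_comm (b.repr u j)]

omit [FiniteDimensional ℝ E] in
theorem ricciForm_eq_sum (Γ : E → E →L[ℝ] E →L[ℝ] E) (y v w : E) :
    ricciForm b Γ y v w = ∑ i, ∑ j, b.repr v i * b.repr w j * ricciForm b Γ y (b i) (b j) := by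
  have h1 : ∀ u w, curvature Γ y u v w = ∑ i, b.repr v i • curvature Γ y u (b i) w := by
    intro u w
    conv_lhs => rw [← b.sum_repr v]
    simp only [curvature, map_sum, map_smul, sum_apply, smul_apply, smul_sub, smul_add,
      Finset.sum_add_distrib, Finset.sum_sub_distrib]
  have h2 : ∀ u v, curvature Γ y u v w = ∑ j, b.repr w j • curvature Γ y u v (b j) := by
    intro u v
    conv_lhs => rw [← b.sum_repr w]
    simp only [curvature, map_sum, map_smul, smul_sub, smul_add,
      Finset.sum_add_distrib, Finset.sum_sub_distrib]
  have h3 : ∀ u, curvature Γ y u v w =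
      ∑ i, ∑ j, (b.repr v i * b.repr w j) • curvature Γ y u (b i) (b j) := by
    intro u
    rw [h1]
    refine Finset.sum_congr rfl fun i _ => ?_
    rw [h2, Finset.smul_sum]
    simp only [smul_smul]
  simp only [ricciForm, h3, map_sum, map_smul, Finsupp.coe_finsetSum, Finset.sum_apply,
    Finsupp.smul_apply, smul_eq_mul]
  rw [Finset.sum_comm]
  refine Finset.sum_congr rfl fun i _ => ?_
  rw [Finset.sum_comm]
  simp only [Finset.mul_sum]

/-- With `P` the Jacobian matrix, both the metric and the Ricci matrix transform as `X ↦ Pᵀ X P`.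
Hence `tr(G⁻¹ Ricᵀ)` is unchanged, by cyclicity of the trace. The hypotheses hold near `y`, not just
at `y`, because the transformation laws get differentiated. -/
theorem scalarCurvIn_pullback {G H : E → Matrix (Fin n) (Fin n) ℝ} {φ : E → E} {y : E}
    (hφ : ∀ᶠ z in 𝓝 y, ContDiffAt ℝ ∞ φ z) (hA : Function.Bijective (fderiv ℝ φ y))
    (hG : ∀ᶠ z in 𝓝 (φ y), ∀ i j, ContDiffAt ℝ ∞ (fun z => G z i j) z)
    (hH : ∀ᶠ z in 𝓝 y, ∀ i j, ContDiffAt ℝ ∞ (fun z => H z i j) z)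
    (hGs : ∀ᶠ z in 𝓝 (φ y), (G z).IsSymm) (hGd : (G (φ y)).det ≠ 0)
    (hGH : ∀ᶠ z in 𝓝 y, ∀ i j, H z i j =
      bilinOfMatrix b (G (φ z)) (fderiv ℝ φ z (b i)) (fderiv ℝ φ z (b j))) :
    scalarCurvIn b H y = scalarCurvIn b G (φ y) := by
  have hφy := hφ.self_of_nhds
  obtain ⟨A, hAA⟩ : ∃ A : E ≃L[ℝ] E, (A : E →L[ℝ] E) = fderiv ℝ φ y :=
    ⟨(LinearEquiv.ofBijective (fderiv ℝ φ y).toLinearMap hA).toContinuousLinearEquiv, by ext; rfl⟩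
  -- Invertible operators form an open set, so `φ` stays a local diffeomorphism near `y`.
  have hbij : ∀ᶠ z in 𝓝 y, Function.Bijective (fderiv ℝ φ z) := by
    have hc : ContinuousAt (fderiv ℝ φ) y := (hφy.fderiv_right (m := ∞) (by simp)).continuousAt
    filter_upwards [hc.eventually ((ContinuousLinearEquiv.isOpen (𝕜 := ℝ) (E := E)
      (F := E)).mem_nhds ⟨A, hAA⟩)] with z ⟨B, hB⟩
    rw [← hB]
    exact B.bijective
  have hφc : Filter.Tendsto φ (𝓝 y) (𝓝 (φ y)) := hφy.continuousAt
  have hGd' : ∀ᶠ z in 𝓝 (φ y), (G z).det ≠ 0 :=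
    (contDiffAt_det hG.self_of_nhds).continuousAt.eventually_ne hGd
  let P : E → Matrix (Fin n) (Fin n) ℝ := fun z => LinearMap.toMatrix b b (fderiv ℝ φ z)
  have hP : ∀ z i j, b.repr (fderiv ℝ φ z (b j)) i = P z i j := fun z i j => by
    simp [P, LinearMap.toMatrix_apply]
  have hPd : ∀ᶠ z in 𝓝 y, (P z).det ≠ 0 := by
    filter_upwards [hbij] with z hz
    have := (LinearEquiv.ofBijective (fderiv ℝ φ z).toLinearMap hz).isUnit_det b b
    exact this.ne_zero
  have hHP : ∀ᶠ z in 𝓝 y, H z = (P z).transpose * G (φ z) * P z := by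
    filter_upwards [hGH] with z hz
    ext i j
    rw [hz, bilinOfMatrix_apply]
    simp only [hP, Matrix.mul_apply, Matrix.transpose_apply, Finset.sum_mul]
    rw [Finset.sum_comm]
    exact Finset.sum_congr rfl fun i _ => Finset.sum_congr rfl fun j _ => by ring
  have hHs : ∀ᶠ z in 𝓝 y, (H z).IsSymm := by
    filter_upwards [hHP, hφc.eventually hGs] with z h1 h2
    rw [h1, Matrix.IsSymm, Matrix.transpose_mul, Matrix.transpose_mul, Matrix.transpose_transpose,
      h2.eq, Matrix.mul_assoc]
  have hHd : ∀ᶠ z in 𝓝 y, (H z).det ≠ 0 := by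
    filter_upwards [hHP, hPd, hφc.eventually hGd'] with z h1 h2 h3
    rw [h1, Matrix.det_mul, Matrix.det_mul, Matrix.det_transpose]
    exact mul_ne_zero (mul_ne_zero h2 h3) h2
  have hbil : ∀ᶠ z in 𝓝 y, ∀ u v, bilinOfMatrix b (H z) u v =
      bilinOfMatrix b (G (φ z)) (fderiv ℝ φ z u) (fderiv ℝ φ z v) := by
    filter_upwards [hGH] with z hz
    have : bilinOfMatrix b (H z) =
        (bilinOfMatrix b (G (φ z))).bilinearComp (fderiv ℝ φ z) (fderiv ℝ φ z) := by
      refine clm_ext_basis b fun i => clm_ext_basis b fun j => ?_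
      rw [bilinOfMatrix_basis, hz, ContinuousLinearMap.bilinearComp_apply]
    intro u v
    rw [this, ContinuousLinearMap.bilinearComp_apply]
  have htr : ∀ᶠ z in 𝓝 y, ∀ u v, fderiv ℝ φ z (christoffelMap b H z u v) =
      fderiv ℝ (fderiv ℝ φ) z u v +
        christoffelMap b G (φ z) (fderiv ℝ φ z u) (fderiv ℝ φ z v) := by
    filter_upwards [hφ, hbij, hφc.eventually hG, hH, hφc.eventually hGd', hHd,
      eventually_eventually_nhds.2 hHs, hφc.eventually (eventually_eventually_nhds.2 hGs),
      eventually_eventually_nhds.2 hbil] with z h1 h2 h3 h4 h5 h6 h7 h8 h9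
    exact christoffel_pullback h1 ((contDiffAt_bilinOfMatrix b h3).differentiableAt (by simp))
      ((contDiffAt_bilinOfMatrix b h4).differentiableAt (by simp)) h9
      (bilinOfMatrix_symm b h8.self_of_nhds)
      (fun u => bilinOfMatrix_nondegenerate b h5) h2.surjective
      (isKoszulAt_christoffelMap b h3 h8 h5) (isKoszulAt_christoffelMap b h4 h7 h6)
  have hHy := hH.self_of_nhds
  have hGy := hG.self_of_nhds
  have hcurv := curvature_pullback hφy
    ((contDiffAt_christoffelMap b hGy hGd).differentiableAt (by simp))
    ((contDiffAt_christoffelMap b hHy hHd.self_of_nhds).differentiableAt (by simp))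
    (christoffelMap_symm b hGs) htr
  have hric : Matrix.of (fun i j => ricciIn b H i j y) =
      (P y).transpose * Matrix.of (fun i j => ricciIn b G i j (φ y)) * P y := by
    ext i j
    have e1 : ricciIn b H i j y = ricciForm b (christoffelMap b H) y (b j) (b i) :=
      ricciIn_eq_sum_curvature b hHy hHs hHd.self_of_nhds i j
    have e2 : ∀ i j, ricciIn b G i j (φ y) =
        ricciForm b (christoffelMap b G) (φ y) (b j) (b i) :=
      ricciIn_eq_sum_curvature b hGy hGs hGd
    have hAu : ∀ u, A u = fderiv ℝ φ y u := fun u => congrArg (fun L : E →L[ℝ] E => L u) hAA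
    rw [Matrix.of_apply, e1, ricciForm_pullback b A (Γ := christoffelMap b G) (y' := φ y)
      (by simpa only [hAu] using hcurv), ricciForm_eq_sum]
    simp only [hAu, hP, Matrix.mul_apply, Matrix.transpose_apply, Finset.sum_mul, Matrix.of_apply,
      e2]
    exact Finset.sum_congr rfl fun i _ => Finset.sum_congr rfl fun j _ => by ring
  have hsc : ∀ (G : E → Matrix (Fin n) (Fin n) ℝ) z, scalarCurvIn b G z =
      ((G z)⁻¹ * (Matrix.of fun i j => ricciIn b G i j z).transpose).trace := by
    intro G z
    simp [scalarCurvIn, Matrix.trace, Matrix.mul_apply]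
  have hPy : IsUnit (P y).det := isUnit_iff_ne_zero.2 hPd.self_of_nhds
  have hPt : IsUnit (P y).transpose.det := by rwa [Matrix.det_transpose]
  rw [hsc, hsc, hric, hHP.self_of_nhds, Matrix.mul_inv_rev, Matrix.mul_inv_rev,
    Matrix.transpose_mul, Matrix.transpose_mul, Matrix.transpose_transpose, Matrix.trace_mul_comm]
  simp only [Matrix.mul_assoc]
  rw [Matrix.mul_nonsing_inv_cancel_left _ _ hPy, Matrix.trace_mul_comm]
  simp only [Matrix.mul_assoc]
  rw [Matrix.nonsing_inv_mul _ hPt, Matrix.mul_one, Matrix.trace_mul_comm]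

theorem christoffel_eq_christoffelIn (G : EuclideanSpace ℝ (Fin n) → Matrix (Fin n) (Fin n) ℝ)
    (k i j : Fin n) : christoffel G k i j =
      christoffelIn (EuclideanSpace.basisFun (Fin n) ℝ).toBasis G k i j := by
  ext y
  simp [christoffel, christoffelIn, partialDeriv]

theorem scalarCurv_eq_scalarCurvIn (G : EuclideanSpace ℝ (Fin n) → Matrix (Fin n) (Fin n) ℝ)
    (y : EuclideanSpace ℝ (Fin n)) :
    scalarCurv G y = scalarCurvIn (EuclideanSpace.basisFun (Fin n) ℝ).toBasis G y := by
  simp [scalarCurv, scalarCurvIn, ricci, ricciIn, partialDeriv, christoffel_eq_christoffelIn]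

end Invariance

/-! ### Energy and momentum density of `K = c g`. -/

section PureTrace

variable {n : ℕ} {G : EuclideanSpace ℝ (Fin n) → Matrix (Fin n) (Fin n) ℝ}
  {y : EuclideanSpace ℝ (Fin n)}

theorem trace_smul_self (c : ℝ) (hs : (G y).IsSymm) (hd : (G y).det ≠ 0) :
    trace G (fun z => c • G z) y = c * n := by
  have h : ((G y)⁻¹ * (G y)).trace = n := by
    rw [Matrix.nonsing_inv_mul _ (isUnit_iff_ne_zero.2 hd), Matrix.trace_one, Fintype.card_fin]
  rw [← h, Matrix.trace, Finset.mul_sum]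
  simp only [trace, Matrix.diag_apply, Matrix.mul_apply, Finset.mul_sum, Matrix.smul_apply,
    smul_eq_mul]
  exact Finset.sum_congr rfl fun i _ => Finset.sum_congr rfl fun j _ => by
    rw [hs.apply j i]; ring

theorem normSqTensor_smul_self (c : ℝ) (hs : (G y).IsSymm) (hd : (G y).det ≠ 0) :
    normSqTensor G (fun z => c • G z) y = c ^ 2 * n := by
  have hu := isUnit_iff_ne_zero.2 hd
  have h1 : ∀ i k, ∑ j, ∑ l, (G y)⁻¹ j l * G y i j * G y k l = G y i k := by
    intro i k
    have : (G y * (G y)⁻¹ * G y) i k = G y i k := by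
      rw [Matrix.mul_nonsing_inv _ hu, Matrix.one_mul]
    rw [← this, Matrix.mul_assoc, Matrix.mul_apply]
    refine Finset.sum_congr rfl fun j _ => ?_
    rw [Matrix.mul_apply, Finset.mul_sum]
    exact Finset.sum_congr rfl fun l _ => by rw [hs.apply l k]; ring
  have h2 := trace_smul_self (c ^ 2) hs hd
  rw [← h2, trace, normSqTensor]
  refine Finset.sum_congr rfl fun i _ => ?_
  rw [Finset.sum_comm]
  refine Finset.sum_congr rfl fun k _ => ?_
  rw [Matrix.smul_apply, smul_eq_mul, ← h1 i k]
  simp only [Finset.mul_sum, Matrix.smul_apply, smul_eq_mul]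
  exact Finset.sum_congr rfl fun j _ => Finset.sum_congr rfl fun l _ => by ring

/-- Metric compatibility: the two lowered Christoffel terms add up to exactly `∂ᵢ g_{jk}`. -/
theorem nabla_smul_self (c : ℝ) (hs : ∀ᶠ z in 𝓝 y, (G z).IsSymm) (hd : (G y).det ≠ 0)
    (hG : ∀ i j, DifferentiableAt ℝ (fun z => G z i j) y)
    (i j k : Fin n) : nabla G (fun z => c • G z) i j k y = 0 := by
  have hsy := hs.self_of_nhds
  have h := sum_mul_christoffelIn (EuclideanSpace.basisFun (Fin n) ℝ).toBasis hsy hd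
  simp only [OrthonormalBasis.coe_toBasis, EuclideanSpace.basisFun_apply] at h
  have h1 := h k i j
  have h2 := h j i k
  rw [fderiv_symm hs k j] at h2
  simp only [nabla, christoffel_eq_christoffelIn, Matrix.smul_apply, smul_eq_mul, partialDeriv]
  rw [fderiv_const_mul (hG j k), Finset.sum_add_distrib]
  have e1 : ∑ l, christoffelIn (EuclideanSpace.basisFun (Fin n) ℝ).toBasis G l i j y *
      (c * G y l k) = c * ∑ l, G y l k *
        christoffelIn (EuclideanSpace.basisFun (Fin n) ℝ).toBasis G l i j y := by
    rw [Finset.mul_sum]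
    exact Finset.sum_congr rfl fun l _ => by ring
  have e2 : ∑ l, christoffelIn (EuclideanSpace.basisFun (Fin n) ℝ).toBasis G l i k y *
      (c * G y j l) = c * ∑ l, G y l j *
        christoffelIn (EuclideanSpace.basisFun (Fin n) ℝ).toBasis G l i k y := by
    rw [Finset.mul_sum]
    exact Finset.sum_congr rfl fun l _ => by rw [hsy.apply l j]; ring
  rw [e1, e2, h1, h2, smul_apply, smul_eq_mul]
  ring

/-- The divergence vanishes with `∇K`, and the trace is the constant `c n` near `y`, so its
differential vanishes too. -/
theorem momentumNorm_smul_self (c : ℝ) (hs : ∀ᶠ z in 𝓝 y, (G z).IsSymm)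
    (hd : ∀ᶠ z in 𝓝 y, (G z).det ≠ 0) (hG : ∀ i j, DifferentiableAt ℝ (fun z => G z i j) y) :
    momentumNorm G (fun z => c • G z) y = 0 := by
  have ht : trace G (fun z => c • G z) =ᶠ[𝓝 y] fun _ => c * n := by
    filter_upwards [hs, hd] with z h1 h2
    exact trace_smul_self c h1 h2
  simp [momentumNorm, momentum, divergence, nabla_smul_self c hs hd.self_of_nhds hG, partialDeriv,
    ht.fderiv_eq]

theorem energy_smul_self (c : ℝ) (hs : (G y).IsSymm) (hd : (G y).det ≠ 0) :
    energy G (fun z => c • G z) y =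
      (1 / 2 : ℝ) * (scalarCurv G y + n * (n - 1) * c ^ 2) := by
  rw [energy, trace_smul_self c hs hd, normSqTensor_smul_self c hs hd]
  ring

end PureTrace

/-! ### Coefficients of bilinear fields in charts, and changes of chart. -/

section Charts

variable {n : ℕ} {M : Type*} [TopologicalSpace M] [ChartedSpace (EuclideanSpace ℝ (Fin n)) M]

/-- Smoothness of a field of bilinear forms, as a section of the bundle of bilinear forms. -/
def BilinField.IsSmooth [IsManifold (𝓡 n) ∞ M] (T : BilinField n M) : Prop :=
  ContMDiff (𝓡 n)
    ((𝓡 n).prod 𝓘(ℝ, EuclideanSpace ℝ (Fin n) →L[ℝ] EuclideanSpace ℝ (Fin n) →L[ℝ] ℝ)) ∞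
    (fun x => TotalSpace.mk' (EuclideanSpace ℝ (Fin n) →L[ℝ] EuclideanSpace ℝ (Fin n) →L[ℝ] ℝ)
      (E := fun x : M => TangentSpace (𝓡 n) x →L[ℝ] TangentSpace (𝓡 n) x →L[ℝ] ℝ) x (T x))

variable [IsManifold (𝓡 n) ∞ M]

/-- The coordinate vector fields are smooth, being the image of a constant section under the tangent
map of the inverse chart. -/
theorem contMDiffOn_mfderiv_symm {e : OpenPartialHomeomorph M (EuclideanSpace ℝ (Fin n))}
    (he : e ∈ IsManifold.maximalAtlas (𝓡 n) ∞ M) (v : EuclideanSpace ℝ (Fin n)) :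
    ContMDiffOn 𝓘(ℝ, EuclideanSpace ℝ (Fin n))
      ((𝓡 n).prod 𝓘(ℝ, EuclideanSpace ℝ (Fin n))) ∞
      (fun y => TotalSpace.mk' (EuclideanSpace ℝ (Fin n)) (E := fun x : M => TangentSpace (𝓡 n) x)
        (e.symm y) (mfderiv 𝓘(ℝ, EuclideanSpace ℝ (Fin n)) (𝓡 n) e.symm y v)) e.target := by
  have h1 : ContMDiffOn 𝓘(ℝ, EuclideanSpace ℝ (Fin n)) (𝓡 n) ∞ e.symm e.target :=
    contMDiffOn_symm_of_mem_maximalAtlas he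
  have : IsManifold (𝓡 n) 1 M := IsManifold.of_le (n := ∞) (by simp)
  have h2 := h1.contMDiffOn_tangentMapWithin (m := ∞) (by simp) e.open_target.uniqueMDiffOn
  have h3 : ContMDiff 𝓘(ℝ, EuclideanSpace ℝ (Fin n))
      (𝓘(ℝ, EuclideanSpace ℝ (Fin n)).prod 𝓘(ℝ, EuclideanSpace ℝ (Fin n))) ∞
      (fun y : EuclideanSpace ℝ (Fin n) => (TotalSpace.mk' (EuclideanSpace ℝ (Fin n)) y v :
        TangentBundle 𝓘(ℝ, EuclideanSpace ℝ (Fin n)) (EuclideanSpace ℝ (Fin n)))) := by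
    intro y
    rw [contMDiffAt_totalSpace]
    refine ⟨contMDiffAt_id, ?_⟩
    simp [contMDiffAt_const]
  have h4 := h2.comp (h3.contMDiffOn (s := e.target)) (fun y hy => hy)
  refine h4.congr fun y hy => ?_
  simp only [Function.comp_def, tangentMapWithin]
  rw [mfderivWithin_of_mem_nhds (e.open_target.mem_nhds hy)]

theorem contDiffOn_coeff {e : OpenPartialHomeomorph M (EuclideanSpace ℝ (Fin n))}
    (he : e ∈ IsManifold.maximalAtlas (𝓡 n) ∞ M) {T : BilinField n M} (hT : T.IsSmooth)
    (i j : Fin n) : ContDiffOn ℝ ∞ (fun y => coeff e T y i j) e.target := by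
  rw [← contMDiffOn_iff_contDiffOn]
  have h1 : ContMDiffOn 𝓘(ℝ, EuclideanSpace ℝ (Fin n)) (𝓡 n) ∞ e.symm e.target :=
    contMDiffOn_symm_of_mem_maximalAtlas he
  have h2 : ContMDiffOn 𝓘(ℝ, EuclideanSpace ℝ (Fin n)) ((𝓡 n).prod 𝓘(ℝ, ℝ)) ∞
      (fun y => TotalSpace.mk' ℝ (E := Bundle.Trivial M ℝ) (e.symm y) (T (e.symm y)
        (mfderiv 𝓘(ℝ, EuclideanSpace ℝ (Fin n)) (𝓡 n) e.symm y (EuclideanSpace.single i 1))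
        (mfderiv 𝓘(ℝ, EuclideanSpace ℝ (Fin n)) (𝓡 n) e.symm y (EuclideanSpace.single j 1))))
      e.target := by
    apply ContMDiffOn.clm_bundle_apply₂ (F₁ := EuclideanSpace ℝ (Fin n))
      (F₂ := EuclideanSpace ℝ (Fin n))
    · exact hT.comp_contMDiffOn h1
    · exact contMDiffOn_mfderiv_symm he _
    · exact contMDiffOn_mfderiv_symm he _
  intro y hy
  have := h2 y hy
  rw [contMDiffWithinAt_totalSpace] at this
  exact this.2

omit [IsManifold (𝓡 n) ∞ M] in
theorem contDiffAt_transition {e e' : OpenPartialHomeomorph M (EuclideanSpace ℝ (Fin n))}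
    (he : e ∈ IsManifold.maximalAtlas (𝓡 n) ∞ M) (he' : e' ∈ IsManifold.maximalAtlas (𝓡 n) ∞ M)
    {y : EuclideanSpace ℝ (Fin n)} (hy : y ∈ e'.target) (hy' : e'.symm y ∈ e.source) :
    ContDiffAt ℝ ∞ (fun z => e (e'.symm z)) y := by
  rw [← contMDiffAt_iff_contDiffAt]
  exact (contMDiffAt_of_mem_maximalAtlas he hy').comp y
    (contMDiffAt_symm_of_mem_maximalAtlas he' hy)

omit [IsManifold (𝓡 n) ∞ M] in
theorem mfderiv_symm_eq {e e' : OpenPartialHomeomorph M (EuclideanSpace ℝ (Fin n))}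
    (he : e ∈ IsManifold.maximalAtlas (𝓡 n) ∞ M) (he' : e' ∈ IsManifold.maximalAtlas (𝓡 n) ∞ M)
    {y : EuclideanSpace ℝ (Fin n)} (hy : y ∈ e'.target) (hy' : e'.symm y ∈ e.source)
    (v : EuclideanSpace ℝ (Fin n)) :
    (mfderiv 𝓘(ℝ, EuclideanSpace ℝ (Fin n)) (𝓡 n) e'.symm y v : EuclideanSpace ℝ (Fin n)) =
      mfderiv 𝓘(ℝ, EuclideanSpace ℝ (Fin n)) (𝓡 n) e.symm (e (e'.symm y))
        (fderiv ℝ (fun z => e (e'.symm z)) y v) := by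
  have h1 : MDifferentiableAt 𝓘(ℝ, EuclideanSpace ℝ (Fin n)) (𝓡 n) e.symm (e (e'.symm y)) :=
    (contMDiffAt_symm_of_mem_maximalAtlas he (e.map_source hy')).mdifferentiableAt (by simp)
  have h2 : MDifferentiableAt 𝓘(ℝ, EuclideanSpace ℝ (Fin n)) 𝓘(ℝ, EuclideanSpace ℝ (Fin n))
      (fun z => e (e'.symm z)) y :=
    ((contDiffAt_transition he he' hy hy').differentiableAt (by simp)).mdifferentiableAt
  have h3 : e'.symm =ᶠ[𝓝 y] e.symm ∘ (fun z => e (e'.symm z)) := by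
    filter_upwards [(e'.continuousAt_symm hy).preimage_mem_nhds (e.open_source.mem_nhds hy')]
      with z hz
    exact (e.left_inv hz).symm
  rw [h3.mfderiv_eq, mfderiv_comp y h1 h2, mfderiv_eq_fderiv]
  rfl

omit [IsManifold (𝓡 n) ∞ M] in
theorem coeff_transition {e e' : OpenPartialHomeomorph M (EuclideanSpace ℝ (Fin n))}
    (he : e ∈ IsManifold.maximalAtlas (𝓡 n) ∞ M) (he' : e' ∈ IsManifold.maximalAtlas (𝓡 n) ∞ M)
    (T : BilinField n M)
    {y : EuclideanSpace ℝ (Fin n)} (hy : y ∈ e'.target) (hy' : e'.symm y ∈ e.source)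
    (i j : Fin n) :
    coeff e' T y i j = bilinOfMatrix (EuclideanSpace.basisFun (Fin n) ℝ).toBasis
      (coeff e T (e (e'.symm y)))
      (fderiv ℝ (fun z => e (e'.symm z)) y (EuclideanSpace.single i 1))
      (fderiv ℝ (fun z => e (e'.symm z)) y (EuclideanSpace.single j 1)) := by
  let T' : M → EuclideanSpace ℝ (Fin n) →L[ℝ] EuclideanSpace ℝ (Fin n) →L[ℝ] ℝ := fun x => T x
  let D : EuclideanSpace ℝ (Fin n) →L[ℝ] EuclideanSpace ℝ (Fin n) :=
    mfderiv 𝓘(ℝ, EuclideanSpace ℝ (Fin n)) (𝓡 n) e.symm (e (e'.symm y))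
  have h1 : bilinOfMatrix (EuclideanSpace.basisFun (Fin n) ℝ).toBasis
      (coeff e T (e (e'.symm y))) = (T' (e.symm (e (e'.symm y)))).bilinearComp D D := by
    refine clm_ext_basis (EuclideanSpace.basisFun (Fin n) ℝ).toBasis fun i =>
      clm_ext_basis (EuclideanSpace.basisFun (Fin n) ℝ).toBasis fun j => ?_
    rw [bilinOfMatrix_basis]
    simp only [OrthonormalBasis.coe_toBasis, EuclideanSpace.basisFun_apply,
      ContinuousLinearMap.bilinearComp_apply]
    rfl
  rw [h1, ContinuousLinearMap.bilinearComp_apply, e.left_inv hy']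
  have h2 := mfderiv_symm_eq he he' hy hy' (EuclideanSpace.single i 1)
  have h3 := mfderiv_symm_eq he he' hy hy' (EuclideanSpace.single j 1)
  exact congr (congrArg (fun v => ⇑(T' (e'.symm y) v)) h2) h3

end Charts

/-! ### Coefficients and curvature of a Riemannian metric on `M`. -/

section Metrics

variable {n : ℕ} {M : Type*} [TopologicalSpace M] [ChartedSpace (EuclideanSpace ℝ (Fin n)) M]

theorem mfderiv_symm_injective {e : OpenPartialHomeomorph M (EuclideanSpace ℝ (Fin n))}
    (he : e ∈ IsManifold.maximalAtlas (𝓡 n) ∞ M) {y : EuclideanSpace ℝ (Fin n)}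
    (hy : y ∈ e.target) : Function.Injective
      (mfderiv 𝓘(ℝ, EuclideanSpace ℝ (Fin n)) (𝓡 n) e.symm y) := by
  have h : e.symm.MDifferentiable 𝓘(ℝ, EuclideanSpace ℝ (Fin n)) (𝓡 n) :=
    ⟨(contMDiffOn_symm_of_mem_maximalAtlas he).mdifferentiableOn (by simp),
      (contMDiffOn_of_mem_maximalAtlas he).mdifferentiableOn (by simp)⟩
  exact h.mfderiv_injective hy

variable [IsManifold (𝓡 n) ∞ M]

theorem Met.isSmooth_field (g : Met n M) : g.field.IsSmooth := ContMDiffRiemannianMetric.contMDiff g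

theorem Met.coeff_isSymm (g : Met n M) (e : OpenPartialHomeomorph M (EuclideanSpace ℝ (Fin n)))
    (y : EuclideanSpace ℝ (Fin n)) : (coeff e g.field y).IsSymm := by
  ext i j
  exact ContMDiffRiemannianMetric.symm g _ _ _

/-- A kernel vector of the coefficient matrix would give a nonzero tangent vector of length zero,
since the derivative of the inverse chart is injective. -/
theorem Met.coeff_det_ne_zero (g : Met n M)
    {e : OpenPartialHomeomorph M (EuclideanSpace ℝ (Fin n))}
    (he : e ∈ IsManifold.maximalAtlas (𝓡 n) ∞ M) {y : EuclideanSpace ℝ (Fin n)}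
    (hy : y ∈ e.target) : (coeff e g.field y).det ≠ 0 := by
  intro h0
  obtain ⟨v, hv, hv0⟩ := Matrix.exists_mulVec_eq_zero_iff.2 h0
  let T : EuclideanSpace ℝ (Fin n) →L[ℝ] EuclideanSpace ℝ (Fin n) →L[ℝ] ℝ := g.field (e.symm y)
  let D : EuclideanSpace ℝ (Fin n) →L[ℝ] EuclideanSpace ℝ (Fin n) :=
    mfderiv 𝓘(ℝ, EuclideanSpace ℝ (Fin n)) (𝓡 n) e.symm y
  have h1 : bilinOfMatrix (EuclideanSpace.basisFun (Fin n) ℝ).toBasis (coeff e g.field y) =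
      T.bilinearComp D D := by
    refine clm_ext_basis (EuclideanSpace.basisFun (Fin n) ℝ).toBasis fun i =>
      clm_ext_basis (EuclideanSpace.basisFun (Fin n) ℝ).toBasis fun j => ?_
    rw [bilinOfMatrix_basis]
    simp only [OrthonormalBasis.coe_toBasis, EuclideanSpace.basisFun_apply,
      ContinuousLinearMap.bilinearComp_apply]
    rfl
  let w : EuclideanSpace ℝ (Fin n) := WithLp.toLp 2 v
  have h2 : T (D w) (D w) = 0 := by
    rw [← ContinuousLinearMap.bilinearComp_apply, ← h1, bilinOfMatrix_eq_dotProduct]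
    have : ⇑((EuclideanSpace.basisFun (Fin n) ℝ).toBasis.repr w) = v := by
      ext i; simp [w]
    rw [this, hv0, dotProduct_zero]
  have h3 : D w ≠ 0 := fun h => hv <| by
    have := mfderiv_symm_injective he hy (h.trans (map_zero D).symm)
    ext i
    exact congrArg (fun u : EuclideanSpace ℝ (Fin n) => u i) this
  exact (ContMDiffRiemannianMetric.pos g (e.symm y) (D w) h3).ne' h2

theorem Met.contDiffAt_coeff (g : Met n M)
    {e : OpenPartialHomeomorph M (EuclideanSpace ℝ (Fin n))}
    (he : e ∈ IsManifold.maximalAtlas (𝓡 n) ∞ M) {y : EuclideanSpace ℝ (Fin n)}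
    (hy : y ∈ e.target) (i j : Fin n) : ContDiffAt ℝ ∞ (fun z => coeff e g.field z i j) y :=
  (contDiffOn_coeff he g.isSmooth_field i j).contDiffAt (e.open_target.mem_nhds hy)

/-- Frees the scalar curvature from the preferred chart at `x`, so that a single chart can be used
for all points near a given one. -/
theorem Met.scal_eq (g : Met n M) {e : OpenPartialHomeomorph M (EuclideanSpace ℝ (Fin n))}
    (he : e ∈ IsManifold.maximalAtlas (𝓡 n) ∞ M) {x : M} (hx : x ∈ e.source) :
    g.scal x = scalarCurv (coeff e g.field) (e x) := by
  set e' := chartAt (EuclideanSpace ℝ (Fin n)) x with he'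
  have hm : e' ∈ IsManifold.maximalAtlas (𝓡 n) ∞ M := IsManifold.chart_mem_maximalAtlas x
  have hxs : x ∈ e'.source := mem_chart_source _ x
  have hy : e' x ∈ e'.target := e'.map_source hxs
  have hy' : e'.symm (e' x) ∈ e.source := by rwa [e'.left_inv hxs]
  have hφ : e (e'.symm (e' x)) = e x := by rw [e'.left_inv hxs]
  have hnear : ∀ᶠ z in 𝓝 (e' x), z ∈ e'.target ∧ e'.symm z ∈ e.source :=
    (e'.open_target.eventually_mem hy).and
      ((e'.continuousAt_symm hy).preimage_mem_nhds (e.open_source.mem_nhds hy'))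
  have hnear' : ∀ᶠ z in 𝓝 (e (e'.symm (e' x))), z ∈ e.target :=
    e.open_target.eventually_mem (e.map_source hy')
  have key := scalarCurvIn_pullback (EuclideanSpace.basisFun (Fin n) ℝ).toBasis
    (G := coeff e g.field) (H := coeff e' g.field) (φ := fun z => e (e'.symm z)) (y := e' x)
    (hnear.mono fun z hz => contDiffAt_transition he hm hz.1 hz.2) ?_
    (hnear'.mono fun z hz => g.contDiffAt_coeff he hz)
    (hnear.mono fun z hz => g.contDiffAt_coeff hm hz.1)
    (Filter.Eventually.of_forall fun z => g.coeff_isSymm e z)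
    (g.coeff_det_ne_zero he (e.map_source hy'))
    (hnear.mono fun z hz i j => by
      simpa using coeff_transition he hm g.field hz.1 hz.2 i j)
  · change scalarCurv (coeff e' g.field) (e' x) = _
    rw [scalarCurv_eq_scalarCurvIn, key, scalarCurv_eq_scalarCurvIn, hφ]
  -- The derivative of `e'.symm` is injective and factors through the derivative of the transition
  -- map.
  · have hinj : Function.Injective (fderiv ℝ (fun z => e (e'.symm z)) (e' x)) := by
      intro u v huv
      refine mfderiv_symm_injective hm hy ?_
      have h1 := mfderiv_symm_eq he hm hy hy' u
      have h2 := mfderiv_symm_eq he hm hy hy' v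
      rw [huv] at h1
      exact h1.trans h2.symm
    exact ⟨hinj, LinearMap.injective_iff_surjective.1 hinj⟩

theorem Met.rho_eq_and_normJ_eq (g : Met n M) (K : SymTensor n M) (c : ℝ)
    (hK : ∀ x, K.field x = c • g.field x) (x : M) :
    Ini.rho (g, K) x = (1 / 2 : ℝ) * (g.scal x + n * (n - 1) * c ^ 2) ∧
      Ini.normJ (g, K) x = 0 := by
  set e := chartAt (EuclideanSpace ℝ (Fin n)) x with he
  have hm : e ∈ IsManifold.maximalAtlas (𝓡 n) ∞ M := IsManifold.chart_mem_maximalAtlas x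
  have hy : e x ∈ e.target := e.map_source (mem_chart_source _ x)
  have hc : coeff e K.field = fun z => c • coeff e g.field z := by
    ext z i j
    simp only [coeff, Matrix.of_apply, hK, Matrix.smul_apply]
    rfl
  constructor
  · change energy (coeff e g.field) (coeff e K.field) (e x) = _
    rw [hc, energy_smul_self c (g.coeff_isSymm e _) (g.coeff_det_ne_zero hm hy)]
    rfl
  · change momentumNorm (coeff e g.field) (coeff e K.field) (e x) = _
    rw [hc]
    exact momentumNorm_smul_self c (Filter.Eventually.of_forall fun z => g.coeff_isSymm e z)
      ((e.open_target.eventually_mem hy).mono fun z hz => g.coeff_det_ne_zero hm hz)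
      fun i j => (g.contDiffAt_coeff hm hy i j).differentiableAt (by simp)

end Metrics

/-! ### Construction of metrics: convex combinations, multiples and existence. -/

section Constructions

/-- Boundedness of unit balls is part of Mathlib's notion of Riemannian metric. In finite dimension
it follows from positivity: `B v v ≥ μ‖v‖²`, with `μ` the minimum of the form on the compact unit
sphere. -/
theorem isVonNBounded_of_pos {E : Type*} [NormedAddCommGroup E] [NormedSpace ℝ E]
    [FiniteDimensional ℝ E] (B : E →L[ℝ] E →L[ℝ] ℝ) (hB : ∀ v, v ≠ 0 → 0 < B v v) :
    Bornology.IsVonNBounded ℝ {v | B v v < 1} := by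
  rw [NormedSpace.isVonNBounded_iff, isBounded_iff_forall_norm_le]
  by_cases hne : (Metric.sphere (0 : E) 1).Nonempty
  · obtain ⟨w, hw, hmin⟩ := (isCompact_sphere (0 : E) 1).exists_isMinOn hne
      (f := fun v => B v v) (by fun_prop)
    have hw0 : w ≠ 0 := by
      rintro rfl
      simp at hw
    refine ⟨Real.sqrt (1 / B w w), fun v hv => Real.le_sqrt_of_sq_le ?_⟩
    rw [le_div_iff₀ (hB w hw0)]
    rcases eq_or_ne v 0 with rfl | hv0
    · simp
    have hn : 0 < ‖v‖ := norm_pos_iff.2 hv0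
    have h1 : B w w ≤ B (‖v‖⁻¹ • v) (‖v‖⁻¹ • v) :=
      hmin (by simp [norm_smul, hn.ne'])
    simp only [map_smul, smul_apply, smul_eq_mul] at h1
    have h2 : ‖v‖ ^ 2 * B w w ≤ ‖v‖ ^ 2 * (‖v‖⁻¹ * (‖v‖⁻¹ * B v v)) := by gcongr
    have h3 : ‖v‖ ^ 2 * (‖v‖⁻¹ * (‖v‖⁻¹ * B v v)) = B v v := by field_simp
    exact (h2.trans_eq h3).trans (le_of_lt hv)
  -- An empty unit sphere means that the space is trivial.
  · refine ⟨0, fun v _ => ?_⟩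
    by_contra hv
    have hv0 : v ≠ 0 := fun h => hv (by simp [h])
    exact hne ⟨‖v‖⁻¹ • v, by simp [norm_smul, hv0]⟩

variable {n : ℕ} {M : Type*} [TopologicalSpace M] [ChartedSpace (EuclideanSpace ℝ (Fin n)) M]
  [IsManifold (𝓡 n) ∞ M]

/-- A metric from a smooth field of symmetric positive definite forms. -/
def Met.ofField (T : BilinField n M) (hs : ∀ x v w, T x v w = T x w v)
    (hp : ∀ x v, v ≠ 0 → 0 < T x v v) (hT : T.IsSmooth) : Met n M where
  inner := T
  symm := hs
  pos := hp
  isVonNBounded x := isVonNBounded_of_pos (E := EuclideanSpace ℝ (Fin n)) (T x) (hp x)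
  contMDiff := hT

theorem BilinField.IsSmooth.add {S T : BilinField n M} (hS : S.IsSmooth) (hT : T.IsSmooth) :
    BilinField.IsSmooth (fun x => S x + T x : BilinField n M) :=
  ContMDiff.add_section (V := fun x : M => TangentSpace (𝓡 n) x →L[ℝ] TangentSpace (𝓡 n) x →L[ℝ] ℝ)
    hS hT

theorem BilinField.IsSmooth.const_smul {T : BilinField n M} (hT : T.IsSmooth) (c : ℝ) :
    BilinField.IsSmooth (fun x => c • T x : BilinField n M) :=
  ContMDiff.const_smul_section
    (V := fun x : M => TangentSpace (𝓡 n) x →L[ℝ] TangentSpace (𝓡 n) x →L[ℝ] ℝ) hT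

/-- The metric `(1 - s) g + s h`. -/
def Met.segment (g h : Met n M) (s : unitInterval) : Met n M :=
  Met.ofField (fun x => (1 - (s : ℝ)) • g.field x + (s : ℝ) • h.field x)
    (fun x v w => by
      change (1 - (s : ℝ)) * g.field x v w + s * h.field x v w =
        (1 - (s : ℝ)) * g.field x w v + s * h.field x w v
      rw [Met.field, Met.field, ContMDiffRiemannianMetric.symm g x v w,
        ContMDiffRiemannianMetric.symm h x v w])
    (fun x v hv => by
      change 0 < (1 - (s : ℝ)) * g.field x v v + s * h.field x v v
      have h1 : 0 < g.field x v v := ContMDiffRiemannianMetric.pos g x v hv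
      have h2 : 0 < h.field x v v := ContMDiffRiemannianMetric.pos h x v hv
      have h3 := s.2.1
      have h4 := s.2.2
      rcases h3.eq_or_lt with h5 | h5
      · simp [← h5, h1]
      · exact add_pos_of_nonneg_of_pos (mul_nonneg (by linarith) h1.le) (mul_pos h5 h2))
    ((g.isSmooth_field.const_smul _).add (h.isSmooth_field.const_smul _))

/-- The symmetric tensor `c g`. -/
def Met.scale (g : Met n M) (c : ℝ) : SymTensor n M where
  field x := c • g.field x
  symm x v w := congrArg (c * ·) (ContMDiffRiemannianMetric.symm g x v w)
  contMDiff := g.isSmooth_field.const_smul c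

theorem Met.field_injective : Function.Injective (Met.field : Met n M → BilinField n M) := by
  rintro ⟨_, _, _, _, _⟩ ⟨_, _, _, _, _⟩ h
  cases h
  rfl

theorem SymTensor.field_injective :
    Function.Injective (SymTensor.field : SymTensor n M → BilinField n M) := by
  rintro ⟨_, _, _⟩ ⟨_, _, _⟩ h
  cases h
  rfl

/-- Inner products form a convex set in each fibre, so a partition of unity glues local ones.
Locally, transport the Euclidean inner product through a trivialization of the tangent bundle. -/
theorem Met.nonempty [T2Space M] [SigmaCompactSpace M] : Nonempty (Met n M) := by
  obtain ⟨s, hs⟩ := exists_contMDiffSection_forall_mem_convex_of_local (n := ⊤) (𝓡 n)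
    (F_fiber := EuclideanSpace ℝ (Fin n) →L[ℝ] EuclideanSpace ℝ (Fin n) →L[ℝ] ℝ)
    (fun x : M => TangentSpace (𝓡 n) x →L[ℝ] TangentSpace (𝓡 n) x →L[ℝ] ℝ)
    (fun x => {B | (∀ v w, B v w = B w v) ∧ ∀ v, v ≠ 0 → 0 < B v v})
    (fun x => by
      intro B hB C hC a b ha hb hab
      refine ⟨fun v w => ?_, fun v hv => ?_⟩
      · simp only [add_apply, smul_apply, hB.1 v w, hC.1 v w]
      · simp only [add_apply, smul_apply, smul_eq_mul]
        rcases ha.eq_or_lt with h | h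
        · have hb1 : b = 1 := by linarith
          simpa [← h, hb1] using hC.2 v hv
        · exact add_pos_of_pos_of_nonneg (mul_pos h (hB.2 v hv)) (mul_nonneg hb (hC.2 v hv).le))
    (fun x₀ => by
      let A := trivializationAt (EuclideanSpace ℝ (Fin n)) (TangentSpace (𝓡 n) (M := M)) x₀
      let t := trivializationAt (EuclideanSpace ℝ (Fin n) →L[ℝ] EuclideanSpace ℝ (Fin n) →L[ℝ] ℝ)
        (fun x : M => TangentSpace (𝓡 n) x →L[ℝ] TangentSpace (𝓡 n) x →L[ℝ] ℝ) x₀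
      let B : EuclideanSpace ℝ (Fin n) →L[ℝ] EuclideanSpace ℝ (Fin n) →L[ℝ] ℝ := innerSL ℝ
      have hbase : t.baseSet ⊆ A.baseSet := fun y hy => by
        simp only [t, hom_trivializationAt_baseSet] at hy
        exact hy.1
      have ht : ∀ y ∈ t.baseSet, t ⟨y, t.symm y B⟩ = (y, B) := fun y hy => t.apply_mk_symm hy B
      refine ⟨t.baseSet, t.open_baseSet.mem_nhds (FiberBundle.mem_baseSet_trivializationAt' x₀),
        fun y => t.symm y B, ?_, fun y hy => ?_⟩
      · rw [t.contMDiffOn_section_baseSet_iff]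
        exact (contMDiffOn_const (c := B)).congr fun y hy => by
          simp only [ht y hy]
      · have h1 : ∀ v w, t.symm y B v w = B (A.linearMapAt ℝ y v) (A.linearMapAt ℝ y w) := by
          intro v w
          have e1 : ContinuousLinearMap.inCoordinates (EuclideanSpace ℝ (Fin n))
              (TangentSpace (𝓡 n) (M := M)) (EuclideanSpace ℝ (Fin n) →L[ℝ] ℝ)
              (fun x : M => TangentSpace (𝓡 n) x →L[ℝ] ℝ) x₀ y x₀ y (t.symm y B) = B :=
            congrArg Prod.snd (ht y hy)
          conv_rhs => rw [← e1]
          rw [inCoordinates_apply_eq₂ (hbase hy) (hbase hy) (Set.mem_univ _)]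
          simp only [A, Trivialization.symm_linearMapAt _ (hbase hy)]
          simp
        have hB : ∀ v w, B v w = inner ℝ v w := fun v w => rfl
        refine ⟨fun v w => ?_, fun v hv => ?_⟩
        · rw [h1, h1, hB, hB]
          exact real_inner_comm _ _
        · rw [h1, hB]
          refine real_inner_self_pos.2 fun h => hv ?_
          rw [← A.symmₗ_linearMapAt (R := ℝ) (hbase hy) v, h, map_zero])
  exact ⟨Met.ofField (fun x => s x) (fun x => (hs x).1) (fun x => (hs x).2) s.contMDiff⟩

end Constructions

/-! ### Functions with derivatives continuous jointly in a parameter and the point. -/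

section Jets

variable {n : ℕ} {X : Type*} [TopologicalSpace X]

/-- A family of functions on `U` whose partial derivatives of order at most `k` exist and are
continuous in the parameter and the point. -/
def JetContinuousOn (U : Set (EuclideanSpace ℝ (Fin n))) :
    ℕ → (X → EuclideanSpace ℝ (Fin n) → ℝ) → Prop
  | 0, f => ContinuousOn (Function.uncurry f) (Set.univ ×ˢ U)
  | k + 1, f => ContinuousOn (Function.uncurry f) (Set.univ ×ˢ U) ∧
      (∀ x, ∀ y ∈ U, DifferentiableAt ℝ (f x) y) ∧
      ∀ i, JetContinuousOn U k fun x => partialDeriv i (f x)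

namespace JetContinuousOn

variable {U : Set (EuclideanSpace ℝ (Fin n))} {k : ℕ} {f g : X → EuclideanSpace ℝ (Fin n) → ℝ}

theorem of_succ (hf : JetContinuousOn U (k + 1) f) : JetContinuousOn U k f := by
  induction k generalizing f with
  | zero => exact hf.1
  | succ k ih => exact ⟨hf.1, hf.2.1, fun i => ih (hf.2.2 i)⟩

theorem congr (hU : IsOpen U) (hf : JetContinuousOn U k f) (h : ∀ x, ∀ y ∈ U, g x y = f x y) :
    JetContinuousOn U k g := by
  induction k generalizing f g with
  | zero => exact ContinuousOn.congr hf fun p hp => h p.1 p.2 hp.2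
  | succ k ih =>
    have he : ∀ x, ∀ y ∈ U, g x =ᶠ[𝓝 y] f x := fun x y hy =>
      (hU.eventually_mem hy).mono fun z hz => h x z hz
    refine ⟨hf.1.congr fun p hp => h p.1 p.2 hp.2,
      fun x y hy => (hf.2.1 x y hy).congr_of_eventuallyEq (he x y hy),
      fun i => ih (hf.2.2 i) fun x y hy => ?_⟩
    rw [partialDeriv, partialDeriv, (he x y hy).fderiv_eq]

theorem const (c : ℝ) : JetContinuousOn (X := X) U k fun _ _ => c := by
  induction k generalizing c with
  | zero => exact continuousOn_const
  | succ k ih =>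
    refine ⟨continuousOn_const, fun _ _ _ => differentiableAt_const c, fun i => ?_⟩
    have : (partialDeriv i fun _ => c) = fun _ : EuclideanSpace ℝ (Fin n) => (0 : ℝ) := by
      ext; simp [partialDeriv]
    simp only [this]
    exact ih 0

theorem add (hU : IsOpen U) (hf : JetContinuousOn U k f) (hg : JetContinuousOn U k g) :
    JetContinuousOn U k fun x y => f x y + g x y := by
  induction k generalizing f g with
  | zero => exact ContinuousOn.add hf hg
  | succ k ih =>
    refine ⟨hf.1.add hg.1, fun x y hy => (hf.2.1 x y hy).add (hg.2.1 x y hy),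
      fun i => (ih (hf.2.2 i) (hg.2.2 i)).congr hU fun x y hy => ?_⟩
    simp only [partialDeriv]
    rw [fderiv_fun_add (hf.2.1 x y hy) (hg.2.1 x y hy)]
    rfl

theorem mul (hU : IsOpen U) (hf : JetContinuousOn U k f) (hg : JetContinuousOn U k g) :
    JetContinuousOn U k fun x y => f x y * g x y := by
  induction k generalizing f g with
  | zero => exact ContinuousOn.mul hf hg
  | succ k ih =>
    refine ⟨hf.1.mul hg.1, fun x y hy => (hf.2.1 x y hy).mul (hg.2.1 x y hy), fun i =>
      ((ih hf.of_succ (hg.2.2 i)).add hU (ih hg.of_succ (hf.2.2 i))).congr hU fun x y hy => ?_⟩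
    simp only [partialDeriv]
    rw [fderiv_fun_mul (hf.2.1 x y hy) (hg.2.1 x y hy)]
    rfl

theorem const_mul (hU : IsOpen U) (c : ℝ) (hf : JetContinuousOn U k f) :
    JetContinuousOn U k fun x y => c * f x y :=
  (const c).mul hU hf

theorem sub (hU : IsOpen U) (hf : JetContinuousOn U k f) (hg : JetContinuousOn U k g) :
    JetContinuousOn U k fun x y => f x y - g x y :=
  (hf.add hU (hg.const_mul hU (-1))).congr hU fun x y _ => by ring

/-- The derivative `-f⁻² ∂f` involves `f⁻¹` only at one order lower, which makes the induction
close. -/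
theorem inv (hU : IsOpen U) (hf : JetContinuousOn U k f) (h0 : ∀ x, ∀ y ∈ U, f x y ≠ 0) :
    JetContinuousOn U k fun x y => (f x y)⁻¹ := by
  induction k with
  | zero => exact ContinuousOn.inv₀ hf fun p hp => h0 p.1 p.2 hp.2
  | succ k ih =>
    refine ⟨hf.1.inv₀ fun p hp => h0 p.1 p.2 hp.2,
      fun x y hy => (hf.2.1 x y hy).inv (h0 x y hy), fun i =>
      ((((ih hf.of_succ).mul hU (ih hf.of_succ)).mul hU (hf.2.2 i)).const_mul hU (-1)).congr hU
        fun x y hy => ?_⟩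
    simp only [partialDeriv]
    have h1 : HasFDerivAt (fun z => (f x z)⁻¹) _ y :=
      (hasDerivAt_inv (h0 x y hy)).comp_hasFDerivAt y (hf.2.1 x y hy).hasFDerivAt
    rw [h1.fderiv, smul_apply, smul_eq_mul]
    ring

theorem sum {ι : Type*} (s : Finset ι) (hU : IsOpen U)
    {F : ι → X → EuclideanSpace ℝ (Fin n) → ℝ} (hF : ∀ a ∈ s, JetContinuousOn U k (F a)) :
    JetContinuousOn U k fun x y => ∑ a ∈ s, F a x y := by
  classical
  induction s using Finset.induction_on with
  | empty => simpa using const 0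
  | insert a s ha ih =>
    simp only [Finset.sum_insert ha]
    exact (hF a (Finset.mem_insert_self a s)).add hU
      (ih fun b hb => hF b (Finset.mem_insert_of_mem hb))

theorem prod {ι : Type*} (s : Finset ι) (hU : IsOpen U)
    {F : ι → X → EuclideanSpace ℝ (Fin n) → ℝ} (hF : ∀ a ∈ s, JetContinuousOn U k (F a)) :
    JetContinuousOn U k fun x y => ∏ a ∈ s, F a x y := by
  classical
  induction s using Finset.induction_on with
  | empty => simpa using const 1
  | insert a s ha ih =>
    simp only [Finset.prod_insert ha]
    exact (hF a (Finset.mem_insert_self a s)).mul hU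
      (ih fun b hb => hF b (Finset.mem_insert_of_mem hb))

variable {G : X → EuclideanSpace ℝ (Fin n) → Matrix (Fin n) (Fin n) ℝ}

theorem det (hU : IsOpen U) (hG : ∀ i j, JetContinuousOn U k fun x y => G x y i j) :
    JetContinuousOn U k fun x y => (G x y).det := by
  simp only [Matrix.det_apply']
  exact sum _ hU fun σ _ => (const _).mul hU (prod _ hU fun i _ => hG _ _)

theorem matrix_inv (hU : IsOpen U) (hG : ∀ i j, JetContinuousOn U k fun x y => G x y i j)
    (hd : ∀ x, ∀ y ∈ U, (G x y).det ≠ 0) (i j : Fin n) :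
    JetContinuousOn U k fun x y => (G x y)⁻¹ i j := by
  simp only [Matrix.inv_def, Matrix.smul_apply, Matrix.adjugate_apply, Ring.inverse_eq_inv',
    smul_eq_mul]
  refine ((det hU hG).inv hU hd).mul hU (det hU fun a b => ?_)
  simp only [Matrix.updateRow_apply]
  split_ifs
  · exact const _
  · exact hG _ _

theorem christoffel (hU : IsOpen U) (hG : ∀ i j, JetContinuousOn U (k + 1) fun x y => G x y i j)
    (hd : ∀ x, ∀ y ∈ U, (G x y).det ≠ 0) (l i j : Fin n) :
    JetContinuousOn U k fun x => InitialData.christoffel (G x) l i j := by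
  unfold InitialData.christoffel
  exact const_mul hU _ (sum _ hU fun m _ =>
    (matrix_inv hU (fun a b => (hG a b).of_succ) hd l m).mul hU
      ((((hG j m).2.2 i).add hU ((hG i m).2.2 j)).sub hU ((hG i j).2.2 m)))

theorem scalarCurv (hU : IsOpen U) (hG : ∀ i j, JetContinuousOn U 2 fun x y => G x y i j)
    (hd : ∀ x, ∀ y ∈ U, (G x y).det ≠ 0) :
    JetContinuousOn U 0 fun x => InitialData.scalarCurv (G x) := by
  have hΓ : ∀ l i j, JetContinuousOn U 1 fun x => InitialData.christoffel (G x) l i j :=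
    fun l i j => christoffel hU hG hd l i j
  have hΓ0 := fun l i j => (hΓ l i j).of_succ
  unfold InitialData.scalarCurv ricci
  refine sum _ hU fun i _ => sum _ hU fun j _ =>
    (matrix_inv hU (fun a b => (hG a b).of_succ.of_succ) hd i j).mul hU (add hU ?_ ?_)
  · exact sum _ hU fun l _ => ((hΓ l i j).2.2 l).sub hU ((hΓ l i l).2.2 j)
  · exact sum _ hU fun l _ => sum _ hU fun m _ =>
      ((hΓ0 l l m).mul hU (hΓ0 m i j)).sub hU ((hΓ0 l j m).mul hU (hΓ0 m i l))

/-- Order two is all that scalar curvature requires. The partial derivatives are evaluations of the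
iterated derivatives at basis vectors, the one taken last coming first. -/
theorem two_of_iteratedFDeriv (hU : IsOpen U) (hf : ∀ x, ContDiffOn ℝ ∞ (f x) U)
    (hc : ∀ k, ContinuousOn (fun p : X × EuclideanSpace ℝ (Fin n) =>
      iteratedFDeriv ℝ k (f p.1) p.2) (Set.univ ×ˢ U)) : JetContinuousOn U 2 f := by
  have hd : ∀ x, ∀ y ∈ U, ContDiffAt ℝ ∞ (f x) y := fun x y hy =>
    (hf x).contDiffAt (hU.mem_nhds hy)
  have hev : ∀ (m : ℕ) (v : Fin m → EuclideanSpace ℝ (Fin n)),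
      ContinuousOn (fun p : X × EuclideanSpace ℝ (Fin n) => iteratedFDeriv ℝ m (f p.1) p.2 v)
        (Set.univ ×ˢ U) := fun m v =>
    (ContinuousMultilinearMap.apply ℝ (fun _ => EuclideanSpace ℝ (Fin n)) ℝ
      v).continuous.comp_continuousOn (hc m)
  refine ⟨(hev 0 ![]).congr fun p _ => ?_, fun x y hy => (hd x y hy).differentiableAt (by simp),
    fun i => ⟨(hev 1 ![EuclideanSpace.single i 1]).congr fun p _ => ?_, fun x y hy =>
      (contDiffAt_fderiv_apply (hd x y hy) _).differentiableAt (by simp), fun j =>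
      (hev 2 ![EuclideanSpace.single j 1, EuclideanSpace.single i 1]).congr fun p hp => ?_⟩⟩
  · simp [Function.uncurry]
  · simp [Function.uncurry, partialDeriv]
  · have h1 : DifferentiableAt ℝ (fderiv ℝ (f p.1)) p.2 :=
      ((hd p.1 p.2 hp.2).fderiv_right (m := ∞) (by simp)).differentiableAt (by simp)
    simp only [Function.uncurry, iteratedFDeriv_two_apply, Matrix.cons_val_zero,
      Matrix.cons_val_one]
    change fderiv ℝ (fun z => fderiv ℝ (f p.1) z (EuclideanSpace.single i 1)) p.2
      (EuclideanSpace.single j 1) = _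
    rw [(h1.hasFDerivAt.clm_apply (hasFDerivAt_const _ _)).fderiv]
    simp

end JetContinuousOn
end Jets

/-! ### The `C^∞`-topology in terms of joint continuity. -/

section SmoothTopology

variable {n : ℕ} {M : Type*} [TopologicalSpace M] [ChartedSpace (EuclideanSpace ℝ (Fin n)) M]
  [IsManifold (𝓡 n) ∞ M]

theorem natCast_le_infty (k : ℕ) : (k : ℕ∞ω) ≤ ∞ := ENat.LEInfty.out

omit [IsManifold (𝓡 n) ∞ M] in
theorem coeff_combination (e : OpenPartialHomeomorph M (EuclideanSpace ℝ (Fin n))) (a b : ℝ)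
    (S T : BilinField n M) (i j : Fin n) :
    (fun y => coeff e (fun z => a • S z + b • T z : BilinField n M) y i j) =
      a • (fun y => coeff e S y i j) + b • (fun y => coeff e T y i j) := rfl

/-- Convergence in the metric is uniform on a compact neighbourhood of the point, and the derivative
for the limiting metric is continuous there. An `ε/2` argument combines the two. -/
theorem continuousOn_iteratedFDeriv_coeff
    {e : OpenPartialHomeomorph M (EuclideanSpace ℝ (Fin n))}
    (he : e ∈ IsManifold.maximalAtlas (𝓡 n) ∞ M) (i j : Fin n) (k : ℕ) :
    ContinuousOn (fun p : Met n M × EuclideanSpace ℝ (Fin n) =>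
      iteratedFDeriv ℝ k (fun y => coeff e p.1.field y i j) p.2) (Set.univ ×ˢ e.target) := by
  have hcont : Continuous fun g : Met n M => UniformOnFun.ofFun
      {C : Set (EuclideanSpace ℝ (Fin n)) | IsCompact C ∧ C ⊆ e.target}
      (iteratedFDeriv ℝ k fun y => coeff e g.field y i j) := by
    have h1 : @Continuous _ _ _ (smoothTopology n M) (Met.field : Met n M → BilinField n M) :=
      continuous_induced_dom
    have h2 := continuous_iInf_rng.1 (continuous_iInf_rng.1 (continuous_iInf_rng.1
      (continuous_iInf_rng.1 (continuous_iInf_rng.1 h1 e) he) i) j) k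
    have h3 : Continuous ((fun T : BilinField n M => UniformOnFun.ofFun
        {C : Set (EuclideanSpace ℝ (Fin n)) | IsCompact C ∧ C ⊆ e.target}
        (iteratedFDeriv ℝ k fun y => coeff e T y i j)) ∘ Met.field) :=
      continuous_induced_rng.1 h2
    exact h3
  rintro ⟨g₀, y₀⟩ ⟨-, hy₀⟩
  refine ContinuousAt.continuousWithinAt ?_
  obtain ⟨C, hC, hyC, hCe⟩ := exists_compact_subset e.open_target hy₀
  have hu := UniformOnFun.tendsto_iff_tendstoUniformlyOn.1 (hcont.tendsto g₀) C ⟨hC, hCe⟩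
  have hy : ContinuousAt (iteratedFDeriv ℝ k fun y => coeff e g₀.field y i j) y₀ := by
    have h3 : ContDiffAt ℝ ∞ (fun y => coeff e g₀.field y i j) y₀ := g₀.contDiffAt_coeff he hy₀ i j
    exact (h3.iteratedFDeriv_right (m := 0) (i := k)
      (by rw [zero_add]; exact natCast_le_infty k)).continuousAt
  rw [Metric.continuousAt_iff'] at hy ⊢
  intro ε hε
  rw [Metric.tendstoUniformlyOn_iff] at hu
  rw [nhds_prod_eq]
  filter_upwards [(hu (ε / 2) (half_pos hε)).prod_mk
    ((hy (ε / 2) (half_pos hε)).and (mem_interior_iff_mem_nhds.1 hyC))] with p hp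
  obtain ⟨hp1, hp2, hp3⟩ := hp
  have h4 := hp1 p.2 hp3
  rw [dist_comm] at h4
  exact (dist_triangle _ _ _).trans_lt ((add_lt_add h4 hp2).trans_eq (add_halves ε))

omit [IsManifold (𝓡 n) ∞ M] in
-- Converse direction: joint continuity gives locally uniform convergence in the point, which
-- compactness turns into uniform convergence on compact sets.
theorem continuous_smoothTopology {X : Type*} [TopologicalSpace X] {F : X → BilinField n M}
    (hF : ∀ e ∈ IsManifold.maximalAtlas (𝓡 n) ∞ M, ∀ i j k,
      ContinuousOn (fun p : X × EuclideanSpace ℝ (Fin n) =>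
        iteratedFDeriv ℝ k (fun y => coeff e (F p.1) y i j) p.2) (Set.univ ×ˢ e.target)) :
    @Continuous _ _ _ (smoothTopology n M) F := by
  refine continuous_iInf_rng.2 fun e => continuous_iInf_rng.2 fun he => continuous_iInf_rng.2
    fun i => continuous_iInf_rng.2 fun j => continuous_iInf_rng.2 fun k =>
      continuous_induced_rng.2 ?_
  rw [continuous_iff_continuousAt]
  intro x₀
  refine UniformOnFun.tendsto_iff_tendstoUniformlyOn.2 fun C hC => ?_
  rw [← tendstoLocallyUniformlyOn_iff_tendstoUniformlyOn_of_compact hC.1,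
    Metric.tendstoLocallyUniformlyOn_iff]
  intro ε hε y hy
  have h1 := (hF e he i j k).continuousAt ((isOpen_univ.prod e.open_target).mem_nhds
    (show (x₀, y) ∈ Set.univ ×ˢ e.target from ⟨trivial, hC.2 hy⟩))
  rw [Metric.continuousAt_iff'] at h1
  have h2 := h1 (ε / 2) (half_pos hε)
  rw [nhds_prod_eq, Filter.eventually_prod_iff] at h2
  obtain ⟨pa, ha, pb, hb, hab⟩ := h2
  refine ⟨{z | pb z}, mem_nhdsWithin_of_mem_nhds hb, ha.mono fun x hx z hz => ?_⟩
  have h3 := hab ha.self_of_nhds hz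
  have h4 := hab hx hz
  rw [dist_comm] at h4
  exact (dist_triangle _ _ _).trans_lt ((add_lt_add h3 h4).trans_eq (add_halves ε))

theorem iteratedFDeriv_combination {E : Type*} [NormedAddCommGroup E] [NormedSpace ℝ E]
    {f h : E → ℝ} {y : E} (hf : ContDiffAt ℝ ∞ f y) (hh : ContDiffAt ℝ ∞ h y) (a b : ℝ) (k : ℕ) :
    iteratedFDeriv ℝ k (a • f + b • h) y =
      a • iteratedFDeriv ℝ k f y + b • iteratedFDeriv ℝ k h y := by
  have h1 := hf.of_le (natCast_le_infty k)
  have h2 := hh.of_le (natCast_le_infty k)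
  have h3 : iteratedFDeriv ℝ k (a • f + b • h) y = _ :=
    iteratedFDeriv_add_apply (h1.const_smul a) (h2.const_smul b)
  rw [h3]
  exact congrArg₂ (· + ·) (iteratedFDeriv_const_smul_apply h1) (iteratedFDeriv_const_smul_apply h2)

theorem continuousOn_iteratedFDeriv_coeff_comp {X : Type*} [TopologicalSpace X]
    {e : OpenPartialHomeomorph M (EuclideanSpace ℝ (Fin n))}
    (he : e ∈ IsManifold.maximalAtlas (𝓡 n) ∞ M) (i j : Fin n) (k : ℕ) {g : X → Met n M}
    (hg : Continuous g) :
    ContinuousOn (fun p : X × EuclideanSpace ℝ (Fin n) =>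
      iteratedFDeriv ℝ k (fun y => coeff e (g p.1).field y i j) p.2) (Set.univ ×ˢ e.target) := by
  have h1 : Continuous fun p : X × EuclideanSpace ℝ (Fin n) => (g p.1, p.2) :=
    (hg.comp continuous_fst).prodMk continuous_snd
  exact ContinuousOn.comp (f := fun p : X × EuclideanSpace ℝ (Fin n) => (g p.1, p.2))
    (s := Set.univ ×ˢ e.target) (continuousOn_iteratedFDeriv_coeff he i j k) h1.continuousOn
    fun p hp => ⟨trivial, hp.2⟩

theorem continuous_combination {X : Type*} [TopologicalSpace X] {a b : X → ℝ} {g h : X → Met n M}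
    (ha : Continuous a) (hb : Continuous b) (hg : Continuous g) (hh : Continuous h) :
    @Continuous _ _ _ (smoothTopology n M)
      fun x => (fun z => a x • (g x).field z + b x • (h x).field z : BilinField n M) := by
  refine continuous_smoothTopology fun e he i j k => ?_
  refine (((ha.comp continuous_fst).continuousOn.smul
    (continuousOn_iteratedFDeriv_coeff_comp he i j k hg)).add
    ((hb.comp continuous_fst).continuousOn.smul
      (continuousOn_iteratedFDeriv_coeff_comp he i j k hh))).congr fun p hp => ?_
  rw [coeff_combination]
  exact iteratedFDeriv_combination ((g p.1).contDiffAt_coeff he hp.2 i j)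
    ((h p.1).contDiffAt_coeff he hp.2 i j) _ _ k

theorem Met.continuous_segment (h : Met n M) :
    Continuous fun p : unitInterval × Met n M => Met.segment p.2 h p.1 :=
  continuous_induced_rng.2 <| continuous_combination
    (continuous_const.sub (continuous_subtype_val.comp continuous_fst))
    (continuous_subtype_val.comp continuous_fst) continuous_snd continuous_const

theorem Met.continuous_scale : Continuous fun p : Met n M × ℝ => Met.scale p.1 p.2 := by
  refine continuous_induced_rng.2 ?_
  have := continuous_combination (n := n) (M := M) (X := Met n M × ℝ) continuous_snd
    (continuous_const (y := (0 : ℝ))) continuous_fst continuous_fst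
  simp only [zero_smul, add_zero] at this
  exact this

theorem continuousOn_scalarCurv_coeff
    {e : OpenPartialHomeomorph M (EuclideanSpace ℝ (Fin n))}
    (he : e ∈ IsManifold.maximalAtlas (𝓡 n) ∞ M) :
    ContinuousOn (fun p : Met n M × EuclideanSpace ℝ (Fin n) =>
      scalarCurv (coeff e p.1.field) p.2) (Set.univ ×ˢ e.target) :=
  JetContinuousOn.scalarCurv (G := fun g : Met n M => coeff e g.field) e.open_target
    (fun i j => JetContinuousOn.two_of_iteratedFDeriv e.open_target
      (fun g => contDiffOn_coeff he g.isSmooth_field i j)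
      (continuousOn_iteratedFDeriv_coeff he i j))
    fun g _ hy => g.coeff_det_ne_zero he hy

/-- In the fixed chart at `x`, scalar curvature is a rational expression in the 2-jet of the metric.
By `Met.scal_eq` this expression equals `scal` at all nearby points. -/
theorem Met.continuous_scal : Continuous fun p : Met n M × M => p.1.scal p.2 := by
  rw [continuous_iff_continuousAt]
  rintro ⟨g, x⟩
  set e := chartAt (EuclideanSpace ℝ (Fin n)) x
  have he : e ∈ IsManifold.maximalAtlas (𝓡 n) ∞ M := IsManifold.chart_mem_maximalAtlas x
  have hx : x ∈ e.source := mem_chart_source _ x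
  have h1 : ContinuousAt (fun p : Met n M × EuclideanSpace ℝ (Fin n) =>
      scalarCurv (coeff e p.1.field) p.2) (g, e x) :=
    (continuousOn_scalarCurv_coeff he).continuousAt ((isOpen_univ.prod e.open_target).mem_nhds
      ⟨trivial, e.map_source hx⟩)
  have h2 : ContinuousAt (fun p : Met n M × M => (p.1, e p.2)) (g, x) :=
    continuousAt_fst.prodMk ((e.continuousAt hx).comp continuousAt_snd)
  refine (ContinuousAt.comp (f := fun p : Met n M × M => (p.1, e p.2)) (x := (g, x))
    h1 h2).congr ?_
  filter_upwards [continuousAt_snd.preimage_mem_nhds (e.open_source.mem_nhds hx)] with p hp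
  exact (p.1.scal_eq he hp).symm

end SmoothTopology

/-! ### The null-homotopy and its effect on homotopy groups. -/

section NullHomotopy

variable {n : ℕ} {M : Type*} [TopologicalSpace M] [ChartedSpace (EuclideanSpace ℝ (Fin n)) M]
  [IsManifold (𝓡 n) ∞ M]

theorem Met.exists_continuous_bound [CompactSpace M] :
    ∃ m : Met n M → ℝ, Continuous m ∧ (∀ g, (∀ x, 0 < g.scal x) → m g < 0) ∧
      ∀ g x, -g.scal x ≤ m g := by
  cases isEmpty_or_nonempty M with
  -- On empty `M` every metric lies in `PSC(M)`, so any negative constant serves; the supremum of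
  -- the empty set would be `0`.
  | inl h => exact ⟨fun _ => -1, continuous_const, fun _ _ => by norm_num, fun _ x => h.elim x⟩
  | inr h =>
    have hc : ∀ g : Met n M, Continuous fun x => -g.scal x := fun g =>
      (Met.continuous_scal.comp (Continuous.prodMk_right g)).neg
    have hm : ∀ g : Met n M, IsCompact ((fun x => -g.scal x) '' Set.univ) := fun g =>
      isCompact_univ.image (hc g)
    refine ⟨fun g => sSup ((fun x => -g.scal x) '' Set.univ), ?_, fun g hg => ?_, fun g x => ?_⟩
    · exact isCompact_univ.continuous_sSup (f := fun (g : Met n M) x => -g.scal x)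
        Met.continuous_scal.neg
    · obtain ⟨x, -, hx⟩ := (hm g).sSup_mem (Set.univ_nonempty.image _)
      exact hx.symm.trans_lt (neg_neg_of_pos (hg x))
    · exact le_csSup (hm g).bddAbove ⟨x, trivial, rfl⟩

theorem Met.segment_zero (g h : Met n M) : g.segment h 0 = g := by
  refine Met.field_injective (funext fun x => ?_)
  change (1 - (0 : ℝ)) • g.field x + (0 : ℝ) • h.field x = _
  rw [sub_zero, one_smul, zero_smul, add_zero]

theorem Met.segment_one (g h : Met n M) : g.segment h 1 = h := by
  refine Met.field_injective (funext fun x => ?_)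
  change (1 - (1 : ℝ)) • g.field x + (1 : ℝ) • h.field x = _
  rw [sub_self, one_smul, zero_smul, zero_add]

theorem Met.segment_self (g : Met n M) (s : unitInterval) : g.segment g s = g := by
  refine Met.field_injective (funext fun x => ?_)
  change (1 - (s : ℝ)) • g.field x + (s : ℝ) • g.field x = _
  rw [← add_smul, sub_add_cancel, one_smul]

theorem Met.scale_zero (g : Met n M) : g.scale 0 = 0 :=
  SymTensor.field_injective (funext fun _ => zero_smul ℝ _)

theorem Met.normJ_lt_rho (hn : 2 ≤ n) (g : Met n M) (c : ℝ)
    (h : ∀ x, 0 < g.scal x + c ^ 2) (x : M) :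
    Ini.normJ (g, g.scale c) x < Ini.rho (g, g.scale c) x := by
  obtain ⟨h1, h2⟩ := g.rho_eq_and_normJ_eq (g.scale c) c (fun _ => rfl) x
  rw [h1, h2]
  have hn' : (2 : ℝ) ≤ n := by exact_mod_cast hn
  have h3 : 1 ≤ (n : ℝ) * (n - 1) := by nlinarith
  have h4 : c ^ 2 ≤ (n : ℝ) * (n - 1) * c ^ 2 := le_mul_of_one_le_left (sq_nonneg c) h3
  linarith [h x]

theorem incl_homotopicRel_const [CompactSpace M] (hn : 2 ≤ n) (g₀ : PSC n M) :
    (incl n M).HomotopicRel (ContinuousMap.const _ (incl n M g₀)) {g₀} := by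
  obtain ⟨m, hm, hneg, hle⟩ := Met.exists_continuous_bound (n := n) (M := M)
  let seg : unitInterval × PSC n M → Met n M := fun p => p.2.1.segment g₀.1 p.1
  -- The term `m(g_s)` compensates the most negative scalar curvature. The minimum is a positive
  -- margin, small enough that the radicand is nonpositive at both ends, where `Real.sqrt` then
  -- returns `0`.
  let u : unitInterval × PSC n M → ℝ := fun p =>
    Real.sqrt (m (seg p) + min (-m p.2.1) (-m g₀.1))
  have hseg : Continuous seg := (Met.continuous_segment g₀.1).comp
    (continuous_fst.prodMk (continuous_subtype_val.comp continuous_snd))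
  have hu : Continuous u := Real.continuous_sqrt.comp
    ((hm.comp hseg).add ((hm.comp (continuous_subtype_val.comp continuous_snd)).neg.min
      continuous_const))
  have hpos : ∀ p x, 0 < (seg p).scal x + u p ^ 2 := by
    intro p x
    have h1 : 0 < min (-m p.2.1) (-m g₀.1) :=
      lt_min (neg_pos.2 (hneg _ p.2.2)) (neg_pos.2 (hneg _ g₀.2))
    have h2 := hle (seg p) x
    rcases le_or_gt 0 (m (seg p) + min (-m p.2.1) (-m g₀.1)) with h3 | h3
    · have h4 : u p ^ 2 = _ := Real.sq_sqrt h3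
      linarith
    -- A negative radicand forces `m(g_s) < 0`, so the metric on the segment already has positive
    -- scalar curvature.
    · nlinarith [sq_nonneg (u p)]
  have hval : ∀ p, u p = 0 → ∀ g : PSC n M, seg p = g.1 →
      ((seg p, (seg p).scale (u p)) : Ini n M) = (incl n M g).1 := by
    intro p hp g hg
    rw [hp, Met.scale_zero, hg]
    rfl
  have h0 : ∀ g : PSC n M, seg (0, g) = g.1 := fun g => Met.segment_zero _ _
  have h1 : ∀ g : PSC n M, seg (1, g) = g₀.1 := fun g => Met.segment_one _ _
  have h2 : ∀ s, seg (s, g₀) = g₀.1 := fun s => Met.segment_self _ _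
  exact ⟨{
    toFun := fun p => ⟨(seg p, (seg p).scale (u p)), Met.normJ_lt_rho hn _ _ (hpos p)⟩
    continuous_toFun :=
      (hseg.prodMk (Met.continuous_scale.comp (hseg.prodMk hu))).subtype_mk _
    map_zero_left := fun g => Subtype.ext <| hval _ (by
      simp only [u, h0]
      exact Real.sqrt_eq_zero_of_nonpos (by linarith [min_le_left (-m g.1) (-m g₀.1)])) _ (h0 g)
    map_one_left := fun g => Subtype.ext <| hval _ (by
      simp only [u, h1]
      exact Real.sqrt_eq_zero_of_nonpos (by linarith [min_le_right (-m g.1) (-m g₀.1)])) _ (h1 g)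
    prop' := by
      rintro s g rfl
      exact Subtype.ext <| hval _ (by
        simp only [u, h2]
        exact Real.sqrt_eq_zero_of_nonpos (by simp)) _ (h2 s) }⟩

theorem incl_nullhomotopic [T2Space M] [CompactSpace M] (hn : 2 ≤ n) :
    (incl n M).Nullhomotopic := by
  by_cases h : Nonempty (PSC n M)
  · obtain ⟨g₀⟩ := h
    obtain ⟨F⟩ := incl_homotopicRel_const hn g₀
    exact ⟨_, ⟨F.toHomotopy⟩⟩
  -- If `PSC(M)` is empty, the map is vacuously constant, but a constant map still needs a value:
  -- `DEC(M)` must be shown nonempty. Any metric works with `c = |m(g)| + 1`, because `c² > m(g) ≥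
  -- -scal`.
  · obtain ⟨g⟩ := Met.nonempty (n := n) (M := M)
    obtain ⟨m, -, -, hle⟩ := Met.exists_continuous_bound (n := n) (M := M)
    let q : DEC n M := ⟨(g, g.scale (|m g| + 1)), Met.normJ_lt_rho hn _ _ fun x => by
      nlinarith [hle g x, le_abs_self (m g), abs_nonneg (m g)]⟩
    have hq : incl n M = ContinuousMap.const _ q := ContinuousMap.ext fun p => (h ⟨p⟩).elim
    exact ⟨q, hq ▸ ContinuousMap.Homotopic.refl _⟩

/-- Composing a sphere with the homotopy keeps `∂I^k` at the base point, because the homotopy is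
relative to `x`; a free null-homotopy would not directly give this. -/
theorem mapPi_eq_zeroPi {X Y : Type*} [TopologicalSpace X] [TopologicalSpace Y] {f : C(X, Y)}
    {x : X} (h : f.HomotopicRel (ContinuousMap.const X (f x)) {x}) (k : ℕ) (c : π_ k X x) :
    mapPi f k x c = zeroPi k (f x) := by
  obtain ⟨F⟩ := h
  induction c using Quotient.inductionOn with
  | h γ =>
    exact Quotient.sound ⟨{
      toFun := fun p => F (p.1, γ p.2)
      continuous_toFun := F.continuous.comp
        (continuous_fst.prodMk (γ.1.continuous.comp continuous_snd))
      map_zero_left := fun y => F.apply_zero _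
      map_one_left := fun y => F.apply_one _
      prop' := fun t y hy => F.eq_fst t (γ.2 y hy) }⟩

end NullHomotopy

end InitialData

end

theorem mainTheorem5 (n : ℕ) (hn : 2 ≤ n) (M : Type*) [TopologicalSpace M] [T2Space M]
    [CompactSpace M] [ChartedSpace (EuclideanSpace ℝ (Fin n)) M] [IsManifold (𝓡 n) ∞ M] :
    (InitialData.incl n M).Nullhomotopic ∧
      ∀ (g₀ : InitialData.PSC n M) (k : ℕ) (c : π_ k (InitialData.PSC n M) g₀),
        InitialData.mapPi (InitialData.incl n M) k g₀ c =
          InitialData.zeroPi k (InitialData.incl n M g₀) :=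
  ⟨InitialData.incl_nullhomotopic hn, fun g₀ k c =>
    InitialData.mapPi_eq_zeroPi (InitialData.incl_homotopicRel_const hn g₀) k c⟩
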